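/- All quantum systems are finite-dimensional. Let $A$ be a quantum system with a Hermitian operator $X_A$ (the conserved quantity), let $U_A$ be a unitary on $A$ and let $\mathcal E$ be a completely positive trace-preserving (CPTP) map from $A$ to $A$. Notation. $F(\rho,\sigma)=\mathrm{Tr}\sqrt{\sqrt\rho\,\sigma\sqrt\rho}$ is the fidelity and $D_F(\rho,\sigma)=\sqrt{1-F(\rho,\sigma)^2}$ the purified distance. $\mathcal F_\rho(X)=4\lim_{t\to0}D_F(e^{-iXt}\rho e^{iXt},\rho)^2/t^2$ is the quantum Fisher information of $\rho$ with respect to the Hermitian operator $X$. $\Delta_W$ is the difference between the maximum and the minimum eigenvalue of a Hermitian operator $W$, and $\|\cdot\|_\infty$ is the operator norm. An implementation of $\mathcal E$ under the conservation law of $X$ is a tuple $(\rho_B,X_B,X_{B'},U)$ consisting of a state $\rho_B$ and a Hermitian operator $X_B$ on a system $B$, a Hermitian operator $X_{B'}$ on a system $B'$, and a unitary $U$ from $A\otimes B$ onto $A\otimes B'$ such that $$\mathcal E(\rho)=\mathrm{Tr}_{B'}\left[U(\rho\otimes\rho_B)U^\dagger\right]\ \text{ for all }\rho,\qquad U^\dagger\left(X_A\otimes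 1_{B'}+1_A\otimes X_{B'}\right)U=X_A\otimes 1_B+1_A\otimes X_B .$$ The implementation cost $\mathcal F^{\mathrm{cost}}_{\mathcal E}\in[0,\infty]$ is the infimum of $\mathcal F_{\rho_B}(X_B)$ over all implementations of $\mathcal E$ ($B$ and $B'$ ranging over all finite-dimensional systems), with the value $\infty$ if there is none. Put $$\mathcal A_{U_A}=\tfrac12\left(\max_\rho\mathrm{Tr}\left[\rho\,(X_A-U_A^\dagger X_AU_A)\right]-\min_\rho\mathrm{Tr}\left[\rho\,(X_A-U_A^\dagger X_AU_A)\right]\right),$$ where $\rho$ runs over all states on $A$. Theorem. Let $\epsilon>0$ and suppose that $D_F(\mathcal E(\rho),U_A\rho U_A^\dagger)\le\epsilon$ for every state $\rho$ on $A$. Then $$\sqrt{\mathcal F^{\mathrm{cost}}_{\mathcal E}}\ \ge\ \frac{\mathcal A_{U_A}}{\sqrt2\,\epsilon}-3\Delta_{X_A}.$$ Moreover $\|[X_A,U_A]\|_\infty\ge\mathcal A_{U_A}\ge\tfrac12\|[X_A,U_A]\|_\infty$, and consequently $$\sqrt{\mathcal F^{\mathrm{cost}}_{\mathcal E}}\ \ge\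 \frac{\|[X_A,U_A]\|_\infty}{2\sqrt2\,\epsilon}-3\Delta_{X_A}.$$ -/

import Mathlib

open scoped Kronecker MatrixOrder ComplexOrder Topology ENNReal

noncomputable section

namespace QCost

/-- A density matrix: positive semidefinite with unit trace. -/
def IsState {n : Type*} [Fintype n] (ρ : Matrix n n ℂ) : Prop :=
  ρ.PosSemidef ∧ ρ.trace = 1

/-- The (root) fidelity `F(ρ, σ) = Tr √(√ρ σ √ρ)` of two states. -/
def fidelity {n : Type*} [Fintype n] [DecidableEq n] (ρ σ : Matrix n n ℂ) : ℝ :=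
  (CFC.sqrt (CFC.sqrt ρ * σ * CFC.sqrt ρ)).trace.re

/-- The purified distance `D_F(ρ, σ) = √(1 - F(ρ, σ)²)`. -/
def purifiedDist {n : Type*} [Fintype n] [DecidableEq n] (ρ σ : Matrix n n ℂ) : ℝ :=
  √(1 - fidelity ρ σ ^ 2)

/-- The translate `e^{-iXt} ρ e^{iXt}`. -/
def translate {n : Type*} [Fintype n] [DecidableEq n] (X ρ : Matrix n n ℂ) (t : ℝ) :
    Matrix n n ℂ :=
  NormedSpace.exp ((-(Complex.I * t)) • X) * ρ * NormedSpace.exp ((Complex.I * t) • X)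

/-- The quantum Fisher information of the family `e^{-iXt} ρ e^{iXt}`,
`4 lim_{t → 0} D_F(e^{-iXt} ρ e^{iXt}, ρ)² / t²`.
For a state `ρ` and a Hermitian `X` this limit exists and is finite, so that it coincides with the
lower limit below; the lower limit only serves to have a total function. -/
def fisherInfo {n : Type*} [Fintype n] [DecidableEq n] (ρ X : Matrix n n ℂ) : ℝ≥0∞ :=
  Filter.liminf
    (fun t : ℝ => ENNReal.ofReal (4 * purifiedDist (translate X ρ t) ρ ^ 2 / t ^ 2)) (𝓝[≠] 0)

/-- The partial trace over the second tensor factor. -/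
def partialTrace {m n : Type*} [Fintype n] (M : Matrix (m × n) (m × n) ℂ) : Matrix m m ℂ :=
  Matrix.of fun i j => ∑ k, M (i, k) (j, k)

/-- The map `E ⊗ id` on matrices over `A ⊗ R`. -/
def ampliation {m n : Type*} (E : Matrix m m ℂ →ₗ[ℂ] Matrix n n ℂ) (r : Type*)
    (M : Matrix (m × r) (m × r) ℂ) : Matrix (n × r) (n × r) ℂ :=
  Matrix.of fun p q => E (Matrix.of fun i j => M (i, p.2) (j, q.2)) p.1 q.1

/-- Completely positive trace-preserving maps. -/
structure IsCPTP {m n : Type*} [Fintype m] [Fintype n]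
    (E : Matrix m m ℂ →ₗ[ℂ] Matrix n n ℂ) : Prop where
  completelyPositive : ∀ (k : ℕ) (M : Matrix (m × Fin k) (m × Fin k) ℂ),
    M.PosSemidef → (ampliation E (Fin k) M).PosSemidef
  tracePreserving : ∀ M, (E M).trace = M.trace

/-- An implementation `(ρ_B, X_B, X_{B'}, U)` of a map `E` from `A` to `A'` under the conservation
law of `X`: a unitary `U` from `A ⊗ B` onto `A' ⊗ B'`, where `B` and `B'` are quantum systems of
arbitrary finite dimensions `b` and `b'`, together with an initial state of `B`. -/
structure Implementation {a a' : Type*} [Fintype a] [DecidableEq a] [Fintype a'] [DecidableEq a']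
    (XA : Matrix a a ℂ) (XA' : Matrix a' a' ℂ) (E : Matrix a a ℂ →ₗ[ℂ] Matrix a' a' ℂ) where
  b : ℕ
  b' : ℕ
  ρB : Matrix (Fin b) (Fin b) ℂ
  XB : Matrix (Fin b) (Fin b) ℂ
  XB' : Matrix (Fin b') (Fin b') ℂ
  U : Matrix (a' × Fin b') (a × Fin b) ℂ
  isState : IsState ρB
  hermitian_XB : XB.IsHermitian
  hermitian_XB' : XB'.IsHermitian
  unitary_left : U.conjTranspose * U = 1
  unitary_right : U * U.conjTranspose = 1
  realizes : ∀ ρ : Matrix a a ℂ, E ρ = partialTrace (U * (ρ ⊗ₖ ρB) * U.conjTranspose)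
  conservation :
    U.conjTranspose * (XA' ⊗ₖ (1 : Matrix (Fin b') (Fin b') ℂ)
        + (1 : Matrix a' a' ℂ) ⊗ₖ XB') * U
      = XA ⊗ₖ (1 : Matrix (Fin b) (Fin b) ℂ) + (1 : Matrix a a ℂ) ⊗ₖ XB

/-- The implementation cost of `E` under the conservation law of `X`: the least quantum Fisher
information `F_{ρ_B}(X_B)` over all implementations (`∞` if there is none). -/
def cost {a a' : Type*} [Fintype a] [DecidableEq a] [Fintype a'] [DecidableEq a']
    (XA : Matrix a a ℂ) (XA' : Matrix a' a' ℂ) (E : Matrix a a ℂ →ₗ[ℂ] Matrix a' a' ℂ) : ℝ≥0∞ :=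
  ⨅ I : Implementation XA XA' E, fisherInfo I.ρB I.XB

/-- `Δ_W`, the difference between the maximum and the minimum eigenvalue of `W`. -/
def eigenSpread {n : Type*} [Fintype n] [DecidableEq n] {W : Matrix n n ℂ}
    (hW : W.IsHermitian) : ℝ :=
  (⨆ i, hW.eigenvalues i) - ⨅ i, hW.eigenvalues i

/-- The set of the expectation values `⟨W⟩_ρ = Tr[ρ W]` over all states `ρ`. -/
def expectations {n : Type*} [Fintype n] (W : Matrix n n ℂ) : Set ℝ :=
  {x | ∃ ρ : Matrix n n ℂ, IsState ρ ∧ x = (ρ * W).trace.re}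

/-- `𝒜_U`, half the difference between the maximum and the minimum over all states `ρ` of
`⟨X - U†XU⟩_ρ`. -/
def asymmetry {n : Type*} [Fintype n] (X U : Matrix n n ℂ) : ℝ :=
  (sSup (expectations (X - U.conjTranspose * X * U))
    - sInf (expectations (X - U.conjTranspose * X * U))) / 2

/-- The operator norm `‖M‖_∞` on the Euclidean space. -/
def opNorm {n : Type*} [Fintype n] [DecidableEq n] (M : Matrix n n ℂ) : ℝ :=
  ‖Matrix.toEuclideanCLM (n := n) (𝕜 := ℂ) M‖

end QCost

end

/-! Composing an implementation with `Uᴴ` gives a unitary `W` that acts on `A` almost as the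
identity, yet turns the conserved quantity `X` of the input into `X' = Uᴴ X U` at the output. The
mismatch `Y = X - X'` has to be supplied by coherence in the ancilla.

Take a rank-one projection `P` on `A` and compare it with its Heisenberg evolution `Q` under `W`,
through the observable `O = Q - P ⊗ 1`, in a state `Φ ⊗ ρ_B`. Since `W` nearly preserves states, the
second moment of `O` is at most `ε²`. On the other hand the conservation law expresses `[1 ⊗ X_B,
O]` by commutators on `A` only: up to errors of order `Δ_X ε`, its expectation is `-Tr Φ[Y, P]`.
With `u`, `w` extremal eigenvectors of `Y`, the choice of `P` onto `(u + iw)/√2` and `Φ` onto `(u +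
w)/√2` makes this of modulus `𝒜_U`.

So the translation generated by `X_B` moves the mean of `O` at a rate near `𝒜_U`, while `O` has root
mean square at most `ε`. A Cramér–Rao type inequality (`ofReal_le_fisherInfo`), proved from
purifications with overlap equal to the fidelity, turns this into the bound on the Fisher
information. `ofReal_le_fisherInfo_of_conservation` contains the commutator argument,
`exists_test_states` the choice of states. The norm comparison follows from `‖[X, U]‖ = ‖Y‖` and `Tr
Y = 0`. -/

noncomputable section

namespace QCost

open Matrix
open scoped Matrix.Norms.L2Operator

/-! ### Cauchy–Schwarz inequalities and expectation values in nearby states. -/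

/-- Cauchy–Schwarz inequality for the Hilbert–Schmidt inner product. -/
theorem norm_trace_conjTranspose_mul_le {m n : Type*} [Fintype m] [Fintype n]
    (S T : Matrix m n ℂ) :
    ‖(Sᴴ * T).trace‖ ≤ √(Sᴴ * S).trace.re * √(Tᴴ * T).trace.re := by
  let v : Matrix m n ℂ → EuclideanSpace ℂ (n × m) := fun A => WithLp.toLp 2 fun p => A p.2 p.1
  have key : ∀ A B : Matrix m n ℂ, inner ℂ (v A) (v B) = (Aᴴ * B).trace := by
    intro A B
    simp only [v, PiLp.inner_apply, Fintype.sum_prod_type, trace, diag, mul_apply,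
      conjTranspose_apply, RCLike.inner_apply]
    exact Finset.sum_congr rfl fun i _ => Finset.sum_congr rfl fun j _ => mul_comm _ _
  have hn : ∀ A : Matrix m n ℂ, √(Aᴴ * A).trace.re = ‖v A‖ := by
    intro A
    rw [← key, inner_self_eq_norm_sq_to_K]
    have : (((‖v A‖ : ℝ) : ℂ) ^ 2).re = ‖v A‖ ^ 2 := by norm_cast
    exact (congrArg Real.sqrt this).trans (Real.sqrt_sq (norm_nonneg _))
  rw [hn, hn, ← key]
  exact norm_inner_le_norm _ _

theorem exists_eq_mul_conjTranspose {n : Type*} [Fintype n] {ρ : Matrix n n ℂ}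
    (hρ : ρ.PosSemidef) : ∃ r : Matrix n n ℂ, ρ = r * rᴴ := by
  classical
  refine ⟨CFC.sqrt ρ, ?_⟩
  rw [(Matrix.nonneg_iff_posSemidef.1 (CFC.sqrt_nonneg ρ)).1,
    CFC.sqrt_mul_sqrt_self ρ (Matrix.nonneg_iff_posSemidef.2 hρ)]

/-- Cauchy–Schwarz inequality for the positive functional `T ↦ Tr[ρ T]`. -/
theorem norm_trace_mul_le {m n : Type*} [Fintype m] [Fintype n] {ρ : Matrix n n ℂ}
    (hρ : ρ.PosSemidef) (S T : Matrix m n ℂ) :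
    ‖(ρ * (Sᴴ * T)).trace‖ ≤ √(ρ * (Sᴴ * S)).trace.re * √(ρ * (Tᴴ * T)).trace.re := by
  obtain ⟨r, rfl⟩ := exists_eq_mul_conjTranspose hρ
  have key : ∀ A B : Matrix m n ℂ,
      (r * rᴴ * (Aᴴ * B)).trace = ((A * r)ᴴ * (B * r)).trace := by
    intro A B
    rw [Matrix.mul_assoc, trace_mul_comm, conjTranspose_mul]
    simp only [Matrix.mul_assoc]
  rw [key, key, key]
  exact norm_trace_conjTranspose_mul_le _ _

theorem trace_mul_re_nonneg {n : Type*} [Fintype n] {ρ T : Matrix n n ℂ}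
    (hρ : ρ.PosSemidef) (hT : T.PosSemidef) : 0 ≤ (ρ * T).trace.re := by
  obtain ⟨r, rfl⟩ := exists_eq_mul_conjTranspose hρ
  rw [Matrix.mul_assoc, trace_mul_comm]
  exact (Complex.le_def.1 (hT.conjTranspose_mul_mul_same r).trace_nonneg).1

/-- In the Loewner order `Tᴴ T ≤ ‖T‖² · 1`, and `ρ` is a positive functional of mass one. -/
theorem trace_mul_conjTranspose_mul_self_le {n : Type*} [Fintype n] [DecidableEq n]
    {ρ : Matrix n n ℂ} (hρ : IsState ρ) (T : Matrix n n ℂ) :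
    (ρ * (Tᴴ * T)).trace.re ≤ ‖T‖ ^ 2 := by
  have h : Tᴴ * T ≤ algebraMap ℝ (Matrix n n ℂ) ‖Tᴴ * T‖ :=
    IsSelfAdjoint.le_algebraMap_norm_self (by exact IsSelfAdjoint.star_mul_self T)
  have h2 := trace_mul_re_nonneg hρ.1 (Matrix.le_iff.1 h)
  rw [← star_eq_conjTranspose, CStarRing.norm_star_mul_self, Algebra.algebraMap_eq_smul_one,
    mul_sub, trace_sub, Complex.sub_re, mul_smul_comm, trace_smul, mul_one, hρ.2] at h2
  rw [← star_eq_conjTranspose]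
  simp only [Complex.real_smul, mul_one, Complex.ofReal_re] at h2
  nlinarith

theorem norm_trace_mul_le_opNorm {n : Type*} [Fintype n] [DecidableEq n]
    {ρ : Matrix n n ℂ} (hρ : IsState ρ) (T : Matrix n n ℂ) : ‖(ρ * T).trace‖ ≤ ‖T‖ := by
  have h := norm_trace_mul_le hρ.1 1 T
  simp only [conjTranspose_one, one_mul, mul_one, hρ.2, Complex.one_re, Real.sqrt_one] at h
  exact h.trans (Real.sqrt_le_iff.2 ⟨norm_nonneg _, trace_mul_conjTranspose_mul_self_le hρ T⟩)

/-- The expectation values of a bounded observable in a state and in a nearby pure state. -/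
theorem norm_trace_mul_sub_le {n : Type*} [Fintype n] [DecidableEq n]
    {τ P T : Matrix n n ℂ} (hτ : IsState τ) (hP : IsState P) (hPP : P * P = P)
    (hPT : P * T * P = (P * T).trace • P) {ε : ℝ} (hε : 0 ≤ ε)
    (h : 1 - ε ^ 2 ≤ (τ * P).trace.re) :
    ‖(τ * T).trace - (P * T).trace‖ ≤ 3 * ‖T‖ * ε := by
  have hPh : Pᴴ = P := hP.1.1
  set G := 1 - P with hG
  have hGh : Gᴴ = G := by simp [hG, hPh]
  have hGG : G * G = G := by rw [hG]; noncomm_ring; rw [hPP]; abel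
  have hs : √(τ * (Gᴴ * G)).trace.re ≤ ε := by
    rw [hGh, hGG]
    refine Real.sqrt_le_iff.2 ⟨hε, ?_⟩
    rw [hG, mul_sub, trace_sub, mul_one, hτ.2]
    simp; linarith
  have h1 : ‖(τ * (T * G)).trace‖ ≤ ‖T‖ * ε := by
    have := norm_trace_mul_le hτ.1 Tᴴ G
    rw [conjTranspose_conjTranspose] at this
    refine this.trans (mul_le_mul ?_ hs (Real.sqrt_nonneg _) (norm_nonneg _))
    refine Real.sqrt_le_iff.2 ⟨norm_nonneg _, ?_⟩
    have := trace_mul_conjTranspose_mul_self_le hτ Tᴴ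
    rwa [conjTranspose_conjTranspose, l2_opNorm_conjTranspose] at this
  have hPn : ‖P‖ ≤ 1 := by
    have := CStarRing.norm_star_mul_self (x := P)
    rw [star_eq_conjTranspose, hPh, hPP] at this
    nlinarith [norm_nonneg P]
  have h2 : ‖(τ * (G * (T * P))).trace‖ ≤ ‖T‖ * ε := by
    have := norm_trace_mul_le hτ.1 G (T * P)
    rw [hGh] at this
    rw [hGh] at hs
    refine this.trans ((mul_le_mul hs ?_ (Real.sqrt_nonneg _) hε).trans_eq (mul_comm _ _))
    refine Real.sqrt_le_iff.2 ⟨norm_nonneg _, ?_⟩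
    refine (trace_mul_conjTranspose_mul_self_le hτ (T * P)).trans ?_
    refine pow_le_pow_left₀ (norm_nonneg _) ((norm_mul_le _ _).trans ?_) 2
    nlinarith [norm_nonneg T]
  have h3 : ‖(τ * G).trace‖ ≤ ε := by
    have := norm_trace_mul_le hτ.1 1 G
    simp only [conjTranspose_one, one_mul, mul_one, hτ.2, Complex.one_re, Real.sqrt_one] at this
    exact this.trans hs
  have key : (τ * T).trace - (P * T).trace =
      (τ * (T * G)).trace + (τ * (G * (T * P))).trace - (P * T).trace * (τ * G).trace := by
    -- The first two summands contain the factor `G`, whose second moment in `τ` is at most `ε²`;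
    -- the third is a multiple of `P`, whose trace against `τ` differs from one by `Tr τG`. Three
    -- errors `‖T‖ ε` result.
    have e : T = T * G + G * (T * P) + P * T * P := by rw [hG]; noncomm_ring
    have e1 : (τ * G).trace = 1 - (τ * P).trace := by
      rw [hG, mul_sub, trace_sub, mul_one, hτ.2]
    have e2 : (τ * T).trace = (τ * (T * G)).trace + (τ * (G * (T * P))).trace
        + (P * T).trace * (τ * P).trace := by
      conv_lhs => rw [e, hPT, mul_add, mul_add, trace_add, trace_add, mul_smul_comm, trace_smul,
        smul_eq_mul]
    rw [e2, e1]; ring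
  rw [key]
  have h4 := norm_trace_mul_le_opNorm hP T
  calc _ ≤ ‖T‖ * ε + ‖T‖ * ε + ‖T‖ * ε := by
        refine (norm_sub_le _ _).trans (add_le_add ((norm_add_le _ _).trans (add_le_add h1 h2)) ?_)
        rw [norm_mul]
        exact mul_le_mul h4 h3 (norm_nonneg _) (norm_nonneg _)
    _ = _ := by ring

/-! ### Polar decomposition, purifications and fidelity. -/

/-- Polar decomposition. -/
theorem exists_unitary_mul_eq {n : Type*} [Fintype n] [DecidableEq n] {M S : Matrix n n ℂ}
    (h : Sᴴ * S = Mᴴ * M) : ∃ V : Matrix n n ℂ, Vᴴ * V = 1 ∧ V * S = M := by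
  let s := Matrix.toEuclideanLin S
  let f := Matrix.toEuclideanLin M
  have hsf : ∀ x, ‖f x‖ = ‖s x‖ := by
    intro x
    have key : ∀ A : Matrix n n ℂ, inner ℂ (Matrix.toEuclideanLin A x) (Matrix.toEuclideanLin A x)
        = inner ℂ x (Matrix.toEuclideanLin (Aᴴ * A) x) := by
      intro A
      have : Matrix.toEuclideanLin (Aᴴ * A) x
          = Matrix.toEuclideanLin Aᴴ (Matrix.toEuclideanLin A x) := by
        ext i; simp [Matrix.toEuclideanLin, Matrix.toLpLin_apply]
      rw [this, Matrix.toEuclideanLin_conjTranspose_eq_adjoint, LinearMap.adjoint_inner_right]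
    have e : inner ℂ (f x) (f x) = inner ℂ (s x) (s x) := by rw [key, key, h]
    rw [inner_self_eq_norm_sq_to_K, inner_self_eq_norm_sq_to_K] at e
    have e' : ‖f x‖ ^ 2 = ‖s x‖ ^ 2 := by exact_mod_cast e
    exact (pow_left_inj₀ (norm_nonneg _) (norm_nonneg _) two_ne_zero).1 e'
  -- `S x ↦ M x` is well defined and isometric on the range of `S`, because `‖M x‖ = ‖S x‖`. It is
  -- built from a section `g` of `S` and then extended to an isometry of the whole space.
  obtain ⟨g, hg⟩ := s.rangeRestrict.exists_rightInverse_of_surjective s.range_rangeRestrict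
  have hg' : ∀ y, s (g y) = y := fun y => congrArg Subtype.val (LinearMap.congr_fun hg y)
  let L : LinearMap.range s →ₗᵢ[ℂ] EuclideanSpace ℂ n :=
    ⟨f ∘ₗ g, fun y => by
      rw [LinearMap.comp_apply, hsf, hg']; rfl⟩
  have hL : ∀ x, L.extend (s x) = f x := by
    intro x
    refine (L.extend_apply (s.rangeRestrict x)).trans ?_
    change f (g (s.rangeRestrict x)) = f x
    rw [← sub_eq_zero, ← map_sub, ← norm_eq_zero, hsf, map_sub, hg']
    exact norm_eq_zero.2 (sub_self _)
  refine ⟨Matrix.toEuclideanLin.symm L.extend.toLinearMap, ?_, ?_⟩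
  · apply Matrix.toEuclideanLin.injective
    refine LinearMap.ext fun x => ext_inner_left ℂ fun y => ?_
    set V := Matrix.toEuclideanLin.symm L.extend.toLinearMap with hV
    have : Matrix.toEuclideanLin (Vᴴ * V) x
        = Matrix.toEuclideanLin Vᴴ (Matrix.toEuclideanLin V x) := by
      ext i; simp [Matrix.toEuclideanLin, Matrix.toLpLin_apply]
    rw [this, Matrix.toEuclideanLin_conjTranspose_eq_adjoint, LinearMap.adjoint_inner_right, hV,
      LinearEquiv.apply_symm_apply]
    have h1 : Matrix.toEuclideanLin (1 : Matrix n n ℂ) x = x := by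
      ext i; simp [Matrix.toEuclideanLin]
    rw [h1]
    exact L.extend.inner_map_map y x
  · apply Matrix.toEuclideanLin.injective
    refine LinearMap.ext fun x => ?_
    set V := Matrix.toEuclideanLin.symm L.extend.toLinearMap with hV
    have : Matrix.toEuclideanLin (V * S) x
        = Matrix.toEuclideanLin V (Matrix.toEuclideanLin S x) := by
      ext i; simp [Matrix.toEuclideanLin, Matrix.toLpLin_apply]
    rw [this, hV, LinearEquiv.apply_symm_apply]
    exact hL x

/-- The fidelity of two states is the overlap of suitable purifications (Uhlmann). -/
theorem exists_purifications {n : Type*} [Fintype n] [DecidableEq n] {ρ σ : Matrix n n ℂ}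
    (hρ : ρ.PosSemidef) (hσ : σ.PosSemidef) :
    ∃ a b : Matrix n n ℂ, a * aᴴ = ρ ∧ b * bᴴ = σ ∧ (aᴴ * b).trace.re = fidelity ρ σ := by
  have sq : ∀ {τ : Matrix n n ℂ}, τ.PosSemidef →
      (CFC.sqrt τ)ᴴ = CFC.sqrt τ ∧ CFC.sqrt τ * CFC.sqrt τ = τ := fun {τ} hτ =>
    ⟨(Matrix.nonneg_iff_posSemidef.1 (CFC.sqrt_nonneg τ)).1,
      CFC.sqrt_mul_sqrt_self τ (Matrix.nonneg_iff_posSemidef.2 hτ)⟩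
  obtain ⟨hr, hrr⟩ := sq hρ
  obtain ⟨hs, hss⟩ := sq hσ
  have hM : (CFC.sqrt ρ * σ * CFC.sqrt ρ).PosSemidef := by
    have := hσ.conjTranspose_mul_mul_same (CFC.sqrt ρ)
    rwa [hr] at this
  obtain ⟨hq, hqq⟩ := sq hM
  -- The unitary `V` that aligns `√σ √ρ` with its modulus also aligns the purifications `√ρ` and `√σ
  -- V`.
  obtain ⟨V, hV, hVS⟩ := exists_unitary_mul_eq
    (M := CFC.sqrt σ * CFC.sqrt ρ) (S := CFC.sqrt (CFC.sqrt ρ * σ * CFC.sqrt ρ)) (by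
      rw [hq, hqq, conjTranspose_mul, hr, hs]
      conv_lhs => rw [← hss]
      simp only [Matrix.mul_assoc])
  refine ⟨CFC.sqrt ρ, CFC.sqrt σ * V, by rw [hr, hrr], ?_, ?_⟩
  · rw [conjTranspose_mul, hs, Matrix.mul_assoc, ← Matrix.mul_assoc V, mul_eq_one_comm.1 hV,
      Matrix.one_mul, hss]
  · rw [fidelity]
    have e : CFC.sqrt (CFC.sqrt ρ * σ * CFC.sqrt ρ) = Vᴴ * (CFC.sqrt σ * CFC.sqrt ρ) := by
      rw [← hVS, ← Matrix.mul_assoc, hV, Matrix.one_mul]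
    have e2 : ((CFC.sqrt ρ)ᴴ * (CFC.sqrt σ * V)) =
        (CFC.sqrt (CFC.sqrt ρ * σ * CFC.sqrt ρ))ᴴ := by
      rw [e]
      simp only [conjTranspose_mul, hr, hs, conjTranspose_conjTranspose, Matrix.mul_assoc]
    rw [e2, hq]

/-- With `c = ‖v‖` the square root of `v v*` is `v v* / c`; the vector `v = 0` needs its own case.
-/
theorem sqrt_vecMulVec {n : Type*} [Fintype n] [DecidableEq n] (v : n → ℂ) :
    (CFC.sqrt (vecMulVec v (star v))).trace.re = √(star v ⬝ᵥ v).re := by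
  have h0 : 0 ≤ star v ⬝ᵥ v := dotProduct_star_self_nonneg v
  set c : ℝ := √(star v ⬝ᵥ v).re with hc
  have hc2 : ((c : ℂ)) ^ 2 = star v ⬝ᵥ v := by
    rw [← Complex.ofReal_pow, hc, Real.sq_sqrt (Complex.le_def.1 h0).1]
    exact Complex.ext (by simp) (by simpa using (Complex.le_def.1 h0).2)
  by_cases hv : c = 0
  · have : v = 0 := by
      apply dotProduct_star_self_eq_zero.1
      rw [← hc2, hv]; simp
    simp [this, hv]
  have hcc : (c : ℂ) ≠ 0 := by exact_mod_cast hv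
  have hsq : CFC.sqrt (vecMulVec v (star v)) = (c : ℂ)⁻¹ • vecMulVec v (star v) := by
    apply CFC.sqrt_unique
    · rw [smul_mul_smul_comm, vecMulVec_mul_vecMulVec, ← hc2, vecMulVec_smul, smul_smul]
      have : (c : ℂ)⁻¹ * (c : ℂ)⁻¹ * (c : ℂ) ^ 2 = 1 := by field_simp
      rw [this, one_smul]
    · refine Matrix.nonneg_iff_posSemidef.2 ((posSemidef_vecMulVec_self_star v).smul ?_)
      rw [← Complex.ofReal_inv]
      exact_mod_cast inv_nonneg.2 (Real.sqrt_nonneg _)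
  rw [hsq, trace_smul, trace_vecMulVec, dotProduct_comm, ← hc2, smul_eq_mul]
  have : (c : ℂ)⁻¹ * (c : ℂ) ^ 2 = c := by field_simp
  rw [this, Complex.ofReal_re]

/-- The fidelity with a pure state. -/
theorem fidelity_vecMulVec {n : Type*} [Fintype n] [DecidableEq n] {τ : Matrix n n ℂ}
    (hτ : τ.PosSemidef) (v : n → ℂ) :
    fidelity τ (vecMulVec v (star v)) ^ 2 = (τ * vecMulVec v (star v)).trace.re := by
  have hr : (CFC.sqrt τ)ᴴ = CFC.sqrt τ := (Matrix.nonneg_iff_posSemidef.1 (CFC.sqrt_nonneg τ)).1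
  have hrr := CFC.sqrt_mul_sqrt_self τ (Matrix.nonneg_iff_posSemidef.2 hτ)
  set w := CFC.sqrt τ *ᵥ v with hw
  have e : CFC.sqrt τ * vecMulVec v (star v) * CFC.sqrt τ = vecMulVec w (star w) := by
    rw [mul_vecMulVec, vecMulVec_mul, hw, star_mulVec, hr]
  have h0 : 0 ≤ star w ⬝ᵥ w := dotProduct_star_self_nonneg w
  rw [fidelity, e, sqrt_vecMulVec, Real.sq_sqrt (Complex.le_def.1 h0).1, dotProduct_comm,
    ← trace_vecMulVec, ← e, Matrix.mul_assoc, trace_mul_comm, Matrix.mul_assoc, hrr, trace_mul_comm]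

/-! ### The lower bound on the quantum Fisher information. -/

/-- Distinguishing two states by the first two moments of an observable. -/
theorem sq_abs_trace_sub_le {n : Type*} [Fintype n] [DecidableEq n] {R S O a b : Matrix n n ℂ}
    (hO : O.IsHermitian) (hR : IsState R) (hS : IsState S) (ha : a * aᴴ = R) (hb : b * bᴴ = S) :
    ((R * O).trace.re - (S * O).trace.re) ^ 2 ≤
      2 * (1 - (aᴴ * b).trace.re) * (√(R * (O * O)).trace.re + √(S * (O * O)).trace.re) ^ 2 := by
  have hRS : ∀ {c Q T : Matrix n n ℂ}, c * cᴴ = Q → (Q * T).trace = (cᴴ * (T * c)).trace := by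
    rintro c Q T rfl
    rw [Matrix.mul_assoc, trace_mul_comm, Matrix.mul_assoc]
  have hconj : (bᴴ * a).trace.re = (aᴴ * b).trace.re := by
    have : (bᴴ * a) = (aᴴ * b)ᴴ := by simp [conjTranspose_mul]
    rw [this, trace_conjTranspose]; simp
  have hna : (aᴴ * a).trace.re = 1 := by
    rw [trace_mul_comm, ha, hR.2, Complex.one_re]
  have hnb : (bᴴ * b).trace.re = 1 := by
    rw [trace_mul_comm, hb, hS.2, Complex.one_re]
  have h1 : ((a - b)ᴴ * (a - b)).trace.re = 2 * (1 - (aᴴ * b).trace.re) := by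
    simp only [conjTranspose_sub, sub_mul, mul_sub, trace_sub, Complex.sub_re, hconj, hna, hnb]
    ring
  -- This is `Re Tr (a - b)ᴴ O (a + b)`: the mixed terms cancel in the real part since `O` is
  -- Hermitian.
  have h2 : (R * O).trace.re - (S * O).trace.re =
      ((a - b)ᴴ * (O * a)).trace.re + ((a - b)ᴴ * (O * b)).trace.re := by
    have : (bᴴ * (O * a)).trace.re = (aᴴ * (O * b)).trace.re := by
      have : bᴴ * (O * a) = (aᴴ * (O * b))ᴴ := by
        simp only [conjTranspose_mul, conjTranspose_conjTranspose, hO.eq, Matrix.mul_assoc]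
      rw [this, trace_conjTranspose]; simp
    rw [hRS ha, hRS hb]
    simp only [conjTranspose_sub, sub_mul, trace_sub, Complex.sub_re, this]
    ring
  have h3 : ∀ {c Q : Matrix n n ℂ}, c * cᴴ = Q →
      |((a - b)ᴴ * (O * c)).trace.re| ≤
        √(2 * (1 - (aᴴ * b).trace.re)) * √(Q * (O * O)).trace.re := by
    intro c Q hc
    refine (Complex.abs_re_le_norm _).trans ((norm_trace_conjTranspose_mul_le _ _).trans_eq ?_)
    rw [h1, hRS hc, conjTranspose_mul, hO.eq]
    simp only [Matrix.mul_assoc]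
  have h4 : 0 ≤ 2 * (1 - (aᴴ * b).trace.re) := by
    rw [← h1]
    exact (Complex.le_def.1 (posSemidef_conjTranspose_mul_self (a - b)).trace_nonneg).1
  rw [h2, ← sq_abs]
  calc _ ≤ (√(2 * (1 - (aᴴ * b).trace.re)) *
        (√(R * (O * O)).trace.re + √(S * (O * O)).trace.re)) ^ 2 := by
        refine pow_le_pow_left₀ (abs_nonneg _) ((abs_add_le _ _).trans ?_) 2
        rw [mul_add]
        exact add_le_add (h3 ha) (h3 hb)
    _ = _ := by rw [mul_pow, Real.sq_sqrt h4]

theorem translate_zero {n : Type*} [Fintype n] [DecidableEq n] (X ρ : Matrix n n ℂ) :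
    translate X ρ 0 = ρ := by
  simp [translate]

theorem isState_translate {n : Type*} [Fintype n] [DecidableEq n] {X ρ : Matrix n n ℂ}
    (hX : X.IsHermitian) (hρ : IsState ρ) (t : ℝ) : IsState (translate X ρ t) := by
  set u := NormedSpace.exp ((-(Complex.I * t)) • X) with hu
  have hv : NormedSpace.exp ((Complex.I * t) • X) = uᴴ := by
    rw [hu, ← Matrix.exp_conjTranspose, conjTranspose_smul, hX.eq]
    congr 2
    simp
  have huu : uᴴ * u = 1 := by
    rw [← hv, hu, neg_smul, Matrix.exp_neg]
    exact Matrix.mul_nonsing_inv _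
      ((Matrix.isUnit_iff_isUnit_det _).1 (Matrix.isUnit_exp _))
  rw [translate, hv]
  refine ⟨hρ.1.mul_mul_conjTranspose_same u, ?_⟩
  rw [trace_mul_comm, ← Matrix.mul_assoc, huu, Matrix.one_mul, hρ.2]

theorem IsState.kronecker {m n : Type*} [Fintype m] [Fintype n] [DecidableEq m] [DecidableEq n]
    {P : Matrix m m ℂ} {ρ : Matrix n n ℂ}
    (hP : IsState P) (hρ : IsState ρ) : IsState (P ⊗ₖ ρ) :=
  ⟨hP.1.kronecker hρ.1, by rw [trace_kronecker, hP.2, hρ.2, one_mul]⟩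

/-- The derivative of an expectation value along the family `e^{-iXt} ρ e^{iXt}`. -/
theorem hasDerivAt_trace_kronecker_translate {m n : Type*} [Fintype m] [DecidableEq m]
    [Fintype n] [DecidableEq n] (P : Matrix m m ℂ) (X ρ : Matrix n n ℂ)
    (O : Matrix (m × n) (m × n) ℂ) :
    HasDerivAt (fun t : ℝ => ((P ⊗ₖ translate X ρ t) * O).trace.re)
      (Complex.I * ((P ⊗ₖ ρ) * ((1 ⊗ₖ X) * O - O * (1 ⊗ₖ X))).trace).re 0 := by
  let l : Matrix n n ℂ →ₗ[ℂ] ℂ :=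
    { toFun := fun M => ((P ⊗ₖ M) * O).trace
      map_add' := fun M N => by rw [kronecker_add, add_mul, trace_add]
      map_smul' := fun c M => by rw [kronecker_smul, smul_mul_assoc, trace_smul]; rfl }
  have h1 := hasDerivAt_exp_smul_const ((-Complex.I) • X) (0 : ℂ)
  have h2 := hasDerivAt_exp_smul_const (Complex.I • X) (0 : ℂ)
  have h3 := (h1.mul_const ρ).mul h2
  have h4 := (LinearMap.toContinuousLinearMap l).hasFDerivAt.comp_hasDerivAt (0 : ℂ) h3
  -- The exponentials are differentiated in a complex parameter; restriction to the real line and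
  -- the real part come only now.
  have h5 := HasDerivAt.real_of_complex (z := 0) (by simpa using h4)
  refine (h5.congr_deriv ?_).congr_of_eventuallyEq (Filter.Eventually.of_forall fun t => ?_)
  · have e : (P ⊗ₖ ρ) * ((1 ⊗ₖ X) * O) = (P ⊗ₖ (ρ * X)) * O := by
      rw [← Matrix.mul_assoc, ← mul_kronecker_mul, mul_one]
    have e2 : ((P ⊗ₖ ρ) * (O * (1 ⊗ₖ X))).trace = ((P ⊗ₖ (X * ρ)) * O).trace := by
      rw [← Matrix.mul_assoc, trace_mul_comm, ← Matrix.mul_assoc, ← mul_kronecker_mul, one_mul]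
    congr 1
    rw [mul_sub, trace_sub, e, e2]
    change _ = Complex.I * (l (ρ * X) - l (X * ρ))
    ring
  · change (l (translate X ρ t)).re = _
    simp [translate, smul_smul, mul_comm]

theorem fidelity_nonneg {n : Type*} [Fintype n] [DecidableEq n] (ρ σ : Matrix n n ℂ) :
    0 ≤ fidelity ρ σ :=
  (Complex.le_def.1 (Matrix.nonneg_iff_posSemidef.1 (CFC.sqrt_nonneg _)).trace_nonneg).1

/-- Distinguishing two states of `B` by the moments of an observable of `A ⊗ B`. -/
theorem sq_trace_kronecker_sub_le {m n : Type*} [Fintype m] [DecidableEq m]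
    [Fintype n] [DecidableEq n] {P : Matrix m m ℂ} {ρ σ : Matrix n n ℂ}
    {O : Matrix (m × n) (m × n) ℂ} (hP : IsState P) (hPP : P * P = P) (hρ : IsState ρ)
    (hσ : IsState σ) (hO : O.IsHermitian) :
    (((P ⊗ₖ ρ) * O).trace.re - ((P ⊗ₖ σ) * O).trace.re) ^ 2 ≤
      2 * purifiedDist ρ σ ^ 2 *
        (√((P ⊗ₖ ρ) * (O * O)).trace.re + √((P ⊗ₖ σ) * (O * O)).trace.re) ^ 2 := by
  obtain ⟨a, b, ha, hb, hab⟩ := exists_purifications hρ.1 hσ.1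
  -- Tensoring with the projection `P` of trace one purifies `P ⊗ τ` without changing overlaps, so
  -- the distance of the two states of `B` controls observables on `A ⊗ B`.
  have hk : ∀ {c τ : Matrix n n ℂ}, c * cᴴ = τ → (P ⊗ₖ c) * (P ⊗ₖ c)ᴴ = P ⊗ₖ τ := by
    rintro c τ rfl
    rw [conjTranspose_kronecker, ← mul_kronecker_mul, hP.1.1, hPP]
  have h := sq_abs_trace_sub_le hO (hP.kronecker hρ) (hP.kronecker hσ) (hk ha) (hk hb)
  have ho : ((P ⊗ₖ a)ᴴ * (P ⊗ₖ b)).trace.re = fidelity ρ σ := by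
    rw [conjTranspose_kronecker, ← mul_kronecker_mul, hP.1.1, hPP, trace_kronecker, hP.2, one_mul,
      hab]
  rw [ho] at h
  refine h.trans (mul_le_mul_of_nonneg_right ?_ (sq_nonneg _))
  have h0 := fidelity_nonneg ρ σ
  have h1 : fidelity ρ σ ≤ 1 := by
    rw [← hab]
    refine (Complex.re_le_norm _).trans ((norm_trace_conjTranspose_mul_le _ _).trans ?_)
    rw [trace_mul_comm, ha, trace_mul_comm bᴴ, hb, hρ.2, hσ.2]
    simp
  -- `1 - F ≤ 1 - F²` for `0 ≤ F ≤ 1`. Near `F = 1` this loses a factor two, which is the source of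
  -- the `√2` in the final bound.
  rw [purifiedDist, Real.sq_sqrt (by nlinarith)]
  nlinarith

/-- Cramér–Rao type lower bound on the quantum Fisher information. -/
theorem ofReal_le_fisherInfo {m n : Type*} [Fintype m] [DecidableEq m]
    [Fintype n] [DecidableEq n] {P : Matrix m m ℂ} {X ρ : Matrix n n ℂ}
    {O : Matrix (m × n) (m × n) ℂ} (hP : IsState P) (hPP : P * P = P) (hρ : IsState ρ)
    (hX : X.IsHermitian) (hO : O.IsHermitian) {ε : ℝ} (hε : 0 < ε)
    (hOε : ((P ⊗ₖ ρ) * (O * O)).trace.re ≤ ε ^ 2) {d : ℝ} (hd : 0 ≤ d)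
    (hdO : d ≤ ‖((P ⊗ₖ ρ) * ((1 ⊗ₖ X) * O - O * (1 ⊗ₖ X))).trace‖) :
    ENNReal.ofReal ((d / (√2 * ε)) ^ 2) ≤ fisherInfo ρ X := by
  set D := ((P ⊗ₖ ρ) * ((1 ⊗ₖ X) * O - O * (1 ⊗ₖ X))).trace with hD
  -- `D` pairs a state with a commutator of Hermitian matrices, hence is purely imaginary, and its
  -- modulus is that of the derivative of `g` at `0`.
  have hDre : ‖D‖ = |(Complex.I * D).re| := by
    have hRh : (P ⊗ₖ ρ)ᴴ = P ⊗ₖ ρ := (hP.kronecker hρ).1.1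
    have hXh : ((1 : Matrix m m ℂ) ⊗ₖ X)ᴴ = 1 ⊗ₖ X := by
      rw [conjTranspose_kronecker, hX.eq, conjTranspose_one]
    have : star D = -D := by
      rw [hD, ← trace_conjTranspose, conjTranspose_mul, conjTranspose_sub, conjTranspose_mul,
        conjTranspose_mul, hXh, hO.eq, hRh, trace_mul_comm, ← trace_neg, ← mul_neg, neg_sub]
    have hre : D.re = 0 := by
      have := congrArg Complex.re this
      simp at this
      linarith
    have : D = D.im * Complex.I := Complex.ext (by simp [hre]) (by simp)
    rw [this]
    simp
  set g : ℝ → ℝ := fun t => ((P ⊗ₖ translate X ρ t) * O).trace.re with hg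
  set s : ℝ → ℝ := fun t => ((P ⊗ₖ translate X ρ t) * (O * O)).trace.re with hs
  have hgd : HasDerivAt g (Complex.I * D).re 0 := hasDerivAt_trace_kronecker_translate P X ρ O
  have hsc : ContinuousAt s 0 := (hasDerivAt_trace_kronecker_translate P X ρ (O * O)).continuousAt
  have hs0 : s 0 ≤ ε ^ 2 := by simpa [hs, translate_zero] using hOε
  -- A minorant of the quotient in `fisherInfo` that converges at `0`; comparing lower limits avoids
  -- showing that the Fisher limit itself exists.
  set h : ℝ → ℝ := fun t => 2 * (t⁻¹ * (g t - g 0)) ^ 2 / (√(s t) + ε) ^ 2 with hh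
  have hpos : ∀ t, 0 < √(s t) + ε := fun t => add_pos_of_nonneg_of_pos (Real.sqrt_nonneg _) hε
  have hlim : Filter.Tendsto h (𝓝[≠] 0) (𝓝 (2 * ((Complex.I * D).re) ^ 2 / (√(s 0) + ε) ^ 2)) := by
    have h1 := hgd.tendsto_slope_zero
    simp only [zero_add, smul_eq_mul] at h1
    have h2 : Filter.Tendsto (fun t => √(s t) + ε) (𝓝[≠] 0) (𝓝 (√(s 0) + ε)) :=
      ((hsc.sqrt).add continuousAt_const).tendsto.mono_left nhdsWithin_le_nhds
    exact ((h1.pow 2).const_mul 2).div (h2.pow 2) (pow_ne_zero _ (hpos 0).ne')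
  have hle : ∀ t, t ≠ 0 → h t ≤ 4 * purifiedDist (translate X ρ t) ρ ^ 2 / t ^ 2 := by
    intro t ht
    have h1 := sq_trace_kronecker_sub_le hP hPP (isState_translate hX hρ t) hρ hO
    have h2 : √((P ⊗ₖ ρ) * (O * O)).trace.re ≤ ε := Real.sqrt_le_iff.2 ⟨hε.le, hOε⟩
    have hg0 : g 0 = ((P ⊗ₖ ρ) * O).trace.re := by simp [hg, translate_zero]
    have h3 : (g t - g 0) ^ 2 ≤
        2 * purifiedDist (translate X ρ t) ρ ^ 2 * (√(s t) + ε) ^ 2 := by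
      rw [hg0]
      refine h1.trans (mul_le_mul_of_nonneg_left ?_ (by positivity))
      exact pow_le_pow_left₀ (by positivity) (by gcongr) 2
    simp only [hh]
    rw [div_le_div_iff₀ (pow_pos (hpos t) 2) (by positivity), mul_pow, inv_pow]
    have : t ^ 2 ≠ 0 := by positivity
    field_simp
    linarith
  have hd2 : (d / (√2 * ε)) ^ 2 ≤ 2 * ((Complex.I * D).re) ^ 2 / (√(s 0) + ε) ^ 2 := by
    have h2 : √(s 0) ≤ ε := Real.sqrt_le_iff.2 ⟨hε.le, hs0⟩
    have h3 : d ^ 2 ≤ ((Complex.I * D).re) ^ 2 := by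
      rw [← sq_abs (Complex.I * D).re, ← hDre]
      exact pow_le_pow_left₀ hd hdO 2
    have h4 : (√(s 0) + ε) ^ 2 ≤ (2 * ε) ^ 2 :=
      pow_le_pow_left₀ (hpos 0).le (by linarith) 2
    calc (d / (√2 * ε)) ^ 2 = 2 * d ^ 2 / (2 * ε) ^ 2 := by
          rw [div_pow, mul_pow, Real.sq_sqrt (by norm_num)]
          field_simp
      _ ≤ _ := by
          have := hpos 0
          gcongr
  calc ENNReal.ofReal ((d / (√2 * ε)) ^ 2)
      ≤ ENNReal.ofReal (2 * ((Complex.I * D).re) ^ 2 / (√(s 0) + ε) ^ 2) :=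
        ENNReal.ofReal_le_ofReal hd2
    _ = Filter.liminf (fun t => ENNReal.ofReal (h t)) (𝓝[≠] 0) :=
        ((ENNReal.continuous_ofReal.tendsto _).comp hlim).liminf_eq.symm
    _ ≤ fisherInfo ρ X := by
        refine Filter.liminf_le_liminf ?_
        filter_upwards [self_mem_nhdsWithin] with t ht
        exact ENNReal.ofReal_le_ofReal (hle t ht)

/-! ### Partial traces and the commutator argument. -/

/-- Tracing out a factor is dual to tensoring with `1`; this passes to the Heisenberg picture. -/
theorem trace_partialTrace_mul {m n : Type*} [Fintype m] [Fintype n] [DecidableEq n]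
    (M : Matrix (m × n) (m × n) ℂ) (T : Matrix m m ℂ) :
    (partialTrace M * T).trace = (M * (T ⊗ₖ (1 : Matrix n n ℂ))).trace := by
  simp only [trace, diag, mul_apply, partialTrace, of_apply, Fintype.sum_prod_type,
    kroneckerMap_apply, one_apply, Finset.sum_mul, mul_ite, mul_one, mul_zero,
    Finset.sum_ite_eq', Finset.mem_univ, if_true]
  exact Finset.sum_congr rfl fun i _ => Finset.sum_comm

theorem IsState.partialTrace {m n : Type*} [Fintype m] [Fintype n] [DecidableEq m]
    {M : Matrix (m × n) (m × n) ℂ} (hM : IsState M) : IsState (partialTrace M) := by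
  classical
  constructor
  · have : QCost.partialTrace M = ∑ k, M.submatrix (fun i => (i, k)) (fun i => (i, k)) := by
      ext i j
      simp [QCost.partialTrace, Matrix.sum_apply]
    rw [this]
    exact posSemidef_sum _ fun k _ => hM.1.submatrix _
  · rw [← hM.2, ← mul_one (QCost.partialTrace M), trace_partialTrace_mul, one_kronecker_one,
      mul_one]

theorem IsState.conj {m n : Type*} [Fintype m] [Fintype n] [DecidableEq n] {ρ : Matrix n n ℂ}
    (hρ : IsState ρ) {V : Matrix m n ℂ} (hV : Vᴴ * V = 1) : IsState (V * ρ * Vᴴ) :=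
  ⟨hρ.1.mul_mul_conjTranspose_same V, by
    rw [trace_mul_comm, ← Matrix.mul_assoc, hV, Matrix.one_mul, hρ.2]⟩

theorem sub_kronecker {m n : Type*} (S T : Matrix m m ℂ) (Z : Matrix n n ℂ) :
    (S - T) ⊗ₖ Z = S ⊗ₖ Z - T ⊗ₖ Z := by
  ext i j
  simp [sub_mul]

/-- Substitute `Xb = K + H - Xa`. The part `H` on the output ancilla commutes with the evolved
projection `Q`, so only charges of `A` remain, whose size is controlled, while that of `Xb` is not.
-/
theorem commutator_eq_of_conservation {R : Type*} [Ring R] {K H Xa Xb Q Pa : R}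
    (h : K + H = Xa + Xb) (hH : H * Q = Q * H) (hP : Xb * Pa = Pa * Xb) :
    Xb * (Q - Pa) - (Q - Pa) * Xb =
      (K * Q - Q * K) - (Xa * (Q - Pa) - (Q - Pa) * Xa) - (Xa * Pa - Pa * Xa) := by
  have e : Xb = K + H - Xa := by rw [h]; abel
  have : Xb * (Q - Pa) - (Q - Pa) * Xb = Xb * Q - Q * Xb - (Xb * Pa - Pa * Xb) := by
    noncomm_ring
  rw [this, hP, sub_self, sub_zero, e]
  have : (K + H - Xa) * Q - Q * (K + H - Xa) =
      (K * Q - Q * K) + (H * Q - Q * H) - (Xa * Q - Q * Xa) := by noncomm_ring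
  rw [this, hH]
  noncomm_ring

/-- No term mixes `P` with `1 - P`, so only the diagonal blocks of the test state `Φ` enter the
second moment. -/
theorem sub_mul_self_of_projection {R : Type*} [Ring R] {Q : R} (P : R) (hQ : Q * Q = Q) :
    (Q - P) * (Q - P) = (1 - P) * Q * (1 - P) + P * (1 - Q) * P := by
  have e1 : (Q - P) * (Q - P) = Q * Q - Q * P - P * Q + P * P := by noncomm_ring
  have e2 : (1 - P) * Q * (1 - P) + P * (1 - Q) * P = Q - Q * P - P * Q + P * P := by
    noncomm_ring
  rw [e1, e2, hQ]

/-- The failure of a covariant implementation to preserve a projection `P` bounds the quantum Fisher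
information of the ancilla from below. -/
theorem ofReal_le_fisherInfo_of_conservation {a b b' : Type*} [Fintype a] [DecidableEq a]
    [Fintype b] [DecidableEq b] [Fintype b'] [DecidableEq b']
    {X X' P P' Φ : Matrix a a ℂ} {ρ XB : Matrix b b ℂ} {XB' : Matrix b' b' ℂ}
    {W : Matrix (a × b') (a × b) ℂ} (hW : Wᴴ * W = 1) (hW' : W * Wᴴ = 1)
    (hρ : IsState ρ) (hX : X.IsHermitian) (hXB : XB.IsHermitian)
    (hcons : Wᴴ * (X' ⊗ₖ (1 : Matrix b' b' ℂ) + (1 : Matrix a a ℂ) ⊗ₖ XB') * W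
      = X ⊗ₖ (1 : Matrix b b ℂ) + (1 : Matrix a a ℂ) ⊗ₖ XB)
    (hP : IsState P) (hPP : P * P = P) (hP' : IsState P') (hPP' : P' * P' = P')
    (hortho : P * P' = 0) (hΦ : IsState Φ) (hΦΦ : Φ * Φ = Φ)
    (hΦT : ∀ T : Matrix a a ℂ, Φ * T * Φ = (Φ * T).trace • Φ)
    (hin : P * Φ * P = (1 / 2 : ℂ) • P) (hout : (1 - P) * Φ * (1 - P) = (1 / 2 : ℂ) • P')
    {κ ε : ℝ} (hε : 0 < ε) (hXκ : ‖X‖ ≤ κ) (hXκ' : ‖X'‖ ≤ κ)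
    (happ : ∀ S ∈ ({P, P', Φ} : Set (Matrix a a ℂ)),
      1 - ε ^ 2 ≤ (partialTrace (W * (S ⊗ₖ ρ) * Wᴴ) * S).trace.re)
    {d : ℝ} (hd : 0 ≤ d)
    (hdA : d ≤ ‖(Φ * ((X - X') * P - P * (X - X'))).trace‖ - 8 * κ * ε) :
    ENNReal.ofReal ((d / (√2 * ε)) ^ 2) ≤ fisherInfo ρ XB := by
  have hκ : 0 ≤ κ := (norm_nonneg _).trans hXκ
  set lift : Matrix a a ℂ → Matrix (a × b) (a × b) ℂ :=
    fun T => Wᴴ * (T ⊗ₖ (1 : Matrix b' b' ℂ)) * W with hlift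
  have lift_mul : ∀ S T, lift S * lift T = lift (S * T) := by
    intro S T
    have : (S * T) ⊗ₖ (1 : Matrix b' b' ℂ) = S ⊗ₖ 1 * (W * Wᴴ) * T ⊗ₖ 1 := by
      rw [hW', mul_one, ← mul_kronecker_mul, one_mul]
    simp only [hlift, this, Matrix.mul_assoc]
  have lift_trace : ∀ S T, ((S ⊗ₖ ρ) * lift T).trace =
      (partialTrace (W * (S ⊗ₖ ρ) * Wᴴ) * T).trace := by
    intro S T
    rw [trace_partialTrace_mul, hlift, ← Matrix.mul_assoc, trace_mul_comm]
    simp only [Matrix.mul_assoc]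
  have hPh : Pᴴ = P := hP.1.1
  have liftP_h : (lift P)ᴴ = lift P := by
    simp only [hlift, conjTranspose_mul, conjTranspose_conjTranspose, conjTranspose_kronecker, hPh,
      conjTranspose_one, Matrix.mul_assoc]
  set Q := lift P with hQ
  set Pa := P ⊗ₖ (1 : Matrix b b ℂ) with hPa
  set Xa := X ⊗ₖ (1 : Matrix b b ℂ) with hXa
  set R := Φ ⊗ₖ ρ with hR
  have hQQ : Q * Q = Q := by rw [hQ, lift_mul, hPP]
  have hPah : Paᴴ = Pa := by rw [hPa, conjTranspose_kronecker, hPh, conjTranspose_one]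
  have hXah : Xaᴴ = Xa := by rw [hXa, conjTranspose_kronecker, hX.eq, conjTranspose_one]
  have hRs : IsState R := hΦ.kronecker hρ
  have hO : (Q - Pa).IsHermitian := by
    rw [Matrix.IsHermitian, conjTranspose_sub, liftP_h, hPah]
  -- the second moment of the observable
  have hO2 : (R * ((Q - Pa) * (Q - Pa))).trace.re ≤ ε ^ 2 := by
    have cyc : ∀ S T : Matrix a a ℂ, ∀ Z : Matrix (a × b) (a × b) ℂ,
        (R * (S ⊗ₖ 1 * Z * T ⊗ₖ 1)).trace = ((T * Φ * S) ⊗ₖ ρ * Z).trace := by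
      intro S T Z
      have : (T * Φ * S) ⊗ₖ ρ = T ⊗ₖ (1 : Matrix b b ℂ) * (Φ ⊗ₖ ρ) * S ⊗ₖ (1 : Matrix b b ℂ) := by
        rw [← mul_kronecker_mul, ← mul_kronecker_mul, one_mul, mul_one]
      rw [this, hR, ← Matrix.mul_assoc, trace_mul_comm]
      simp only [Matrix.mul_assoc]
    have hsub : 1 - Pa = (1 - P) ⊗ₖ (1 : Matrix b b ℂ) := by
      rw [hPa, ← one_kronecker_one, sub_kronecker]
    have e1 := happ P (by simp)
    have e2 := happ P' (by simp)
    -- `P` and `P'` are orthogonal, so finding `P` is at most as likely as missing `P'`.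
    have e3 : (partialTrace (W * (P' ⊗ₖ ρ) * Wᴴ) * P).trace.re ≤ ε ^ 2 := by
      have hst := ((hP'.kronecker hρ).conj hW).partialTrace
      set τ := partialTrace (W * (P' ⊗ₖ ρ) * Wᴴ)
      have hps : (1 - P' - P).PosSemidef := by
        have hP'h : P'ᴴ = P' := hP'.1.1
        have hortho' : P' * P = 0 := by
          have := congrArg conjTranspose hortho
          rwa [conjTranspose_mul, hPh, hP'h, conjTranspose_zero] at this
        have : 1 - P' - P = (1 - P' - P)ᴴ * (1 - P' - P) := by
          rw [conjTranspose_sub, conjTranspose_sub, conjTranspose_one, hPh, hP'h]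
          have : (1 - P' - P) * (1 - P' - P) =
              1 - P' - P - P' - P + P' * P' + P * P + P * P' + P' * P := by noncomm_ring
          rw [this, hPP, hPP', hortho, hortho']
          abel
        rw [this]
        exact posSemidef_conjTranspose_mul_self _
      have := trace_mul_re_nonneg hst.1 hps
      rw [mul_sub, mul_sub, trace_sub, trace_sub, mul_one, hst.2, Complex.sub_re, Complex.sub_re,
        Complex.one_re] at this
      linarith
    -- The diagonal blocks of `Φ` are `P/2` and `P'/2`: the second moment is the average of two
    -- error probabilities, each at most `ε²`.
    rw [sub_mul_self_of_projection Pa hQQ, mul_add, trace_add, hsub, cyc, hPa, cyc, hin, hout,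
      smul_kronecker, smul_kronecker, smul_mul_assoc, smul_mul_assoc, trace_smul, trace_smul,
      hQ, lift_trace, mul_sub, trace_sub, mul_one, lift_trace, trace_kronecker, hP.2, hρ.2]
    simp only [smul_eq_mul, Complex.add_re, Complex.mul_re, Complex.sub_re]
    norm_num
    linarith
  refine ofReal_le_fisherInfo hΦ hΦΦ hρ hXB hO hε hO2 hd (hdA.trans ?_)
  -- the commutator with the conserved quantity
  have hcomm := commutator_eq_of_conservation (K := lift X')
    (H := Wᴴ * ((1 : Matrix a a ℂ) ⊗ₖ XB') * W) (Q := Q) (Pa := Pa) (Xa := Xa)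
    (Xb := (1 : Matrix a a ℂ) ⊗ₖ XB)
    (by rw [← hcons, Matrix.mul_add, Matrix.add_mul])
    (by
      have e1 : (Wᴴ * ((1 : Matrix a a ℂ) ⊗ₖ XB') * W) * (Wᴴ * (P ⊗ₖ (1 : Matrix b' b' ℂ)) * W) =
          Wᴴ * (((1 : Matrix a a ℂ) ⊗ₖ XB') * (W * Wᴴ) * (P ⊗ₖ (1 : Matrix b' b' ℂ))) * W := by
        simp only [Matrix.mul_assoc]
      have e2 : (Wᴴ * (P ⊗ₖ (1 : Matrix b' b' ℂ)) * W) * (Wᴴ * ((1 : Matrix a a ℂ) ⊗ₖ XB') * W) =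
          Wᴴ * ((P ⊗ₖ (1 : Matrix b' b' ℂ)) * (W * Wᴴ) * ((1 : Matrix a a ℂ) ⊗ₖ XB')) * W := by
        simp only [Matrix.mul_assoc]
      rw [hQ, hlift, e1, e2, hW', mul_one, mul_one, ← mul_kronecker_mul, ← mul_kronecker_mul]
      simp)
    (by rw [hPa, ← mul_kronecker_mul, ← mul_kronecker_mul]; simp)
  set τ := partialTrace (W * R * Wᴴ) with hτ
  have hτs : IsState τ := (hRs.conj hW).partialTrace
  -- Here `6κ = 3 · 2κ`, as the commutator has norm at most `2κ`. Together with the `2κε` of `h2`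
  -- this gives the loss `8κε`.
  have h1 : ‖(τ * (X' * P - P * X')).trace - (Φ * (X' * P - P * X')).trace‖ ≤ 6 * κ * ε := by
    refine (norm_trace_mul_sub_le hτs hΦ hΦΦ (hΦT _) hε.le (happ Φ (by simp))).trans ?_
    have hPn : ‖P‖ ≤ 1 := by
      have := CStarRing.norm_star_mul_self (x := P)
      rw [star_eq_conjTranspose, hPh, hPP] at this
      nlinarith [norm_nonneg P]
    have : ‖X' * P - P * X'‖ ≤ κ + κ := by
      refine (norm_sub_le _ _).trans (add_le_add ?_ ?_)
      · refine (norm_mul_le _ _).trans ?_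
        nlinarith [norm_nonneg P, norm_nonneg X']
      · refine (norm_mul_le _ _).trans ?_
        nlinarith [norm_nonneg P, norm_nonneg X']
    nlinarith
  have hXa2 : √(R * (Xaᴴ * Xa)).trace.re ≤ κ := by
    refine Real.sqrt_le_iff.2 ⟨hκ, ?_⟩
    have := trace_mul_conjTranspose_mul_self_le hΦ X
    rw [hX.eq] at this
    rw [hXah, hR, hXa, ← mul_kronecker_mul, ← mul_kronecker_mul, trace_kronecker, mul_one,
      mul_one, hρ.2, mul_one]
    exact this.trans (pow_le_pow_left₀ (norm_nonneg _) hXκ 2)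
  have hO2' : √(R * ((Q - Pa)ᴴ * (Q - Pa))).trace.re ≤ ε := by
    rw [hO.eq]
    exact Real.sqrt_le_iff.2 ⟨hε.le, hO2⟩
  have h2 : ‖(R * (Xa * (Q - Pa) - (Q - Pa) * Xa)).trace‖ ≤ 2 * κ * ε := by
    have e1 := norm_trace_mul_le hRs.1 Xa (Q - Pa)
    have e2 := norm_trace_mul_le hRs.1 (Q - Pa) Xa
    have e3 := mul_le_mul hXa2 hO2' (Real.sqrt_nonneg _) hκ
    rw [mul_comm] at e2
    rw [hXah] at e1 e3 e2
    rw [hO.eq] at e1 e2 e3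
    rw [mul_sub, trace_sub]
    refine (norm_sub_le _ _).trans ((add_le_add (e1.trans e3) (e2.trans e3)).trans_eq ?_)
    ring
  have h3 : (R * (Xa * Pa - Pa * Xa)).trace = (Φ * (X * P - P * X)).trace := by
    rw [hXa, hPa, hR, ← mul_kronecker_mul, ← mul_kronecker_mul, ← sub_kronecker,
      ← mul_kronecker_mul, trace_kronecker, one_mul, mul_one, hρ.2, mul_one]
  have h4 : (R * (lift X' * Q - Q * lift X')).trace = (τ * (X' * P - P * X')).trace := by
    rw [hQ, lift_mul, lift_mul, mul_sub, trace_sub, hR, lift_trace, lift_trace, mul_sub, trace_sub]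
  have h5 : (Φ * ((X - X') * P - P * (X - X'))).trace =
      (Φ * (X * P - P * X)).trace - (Φ * (X' * P - P * X')).trace := by
    rw [← trace_sub, ← mul_sub]
    congr 2
    noncomm_ring
  rw [h5, hcomm, ← hR, mul_sub R, mul_sub R, trace_sub, trace_sub, h3, h4]
  set A := (Φ * (X * P - P * X)).trace
  set B := (Φ * (X' * P - P * X')).trace
  set C := (τ * (X' * P - P * X')).trace
  set E := (R * (Xa * (Q - Pa) - (Q - Pa) * Xa)).trace
  have h6 : A - B = (C - B) - E - (C - E - A) := by ring
  have h7 : ‖A - B‖ ≤ ‖C - B‖ + ‖E‖ + ‖C - E - A‖ := by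
    conv_lhs => rw [h6]
    exact (norm_sub_le _ _).trans (add_le_add_left (norm_sub_le _ _) _)
  linarith

/-! ### Extremal eigenvalues and test states. -/

theorem eq_eigenvectorUnitary_mul {n : Type*} [Fintype n] [DecidableEq n] {W : Matrix n n ℂ}
    (hW : W.IsHermitian) :
    W = (hW.eigenvectorUnitary : Matrix n n ℂ) * diagonal (fun i => (hW.eigenvalues i : ℂ)) *
      star (hW.eigenvectorUnitary : Matrix n n ℂ) := by
  conv_lhs => rw [hW.spectral_theorem, Unitary.conjStarAlgAut_apply]
  rfl

theorem norm_unitary_conj {n : Type*} [Fintype n] [DecidableEq n] (V : unitaryGroup n ℂ)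
    (T : Matrix n n ℂ) : ‖(V : Matrix n n ℂ) * T * star (V : Matrix n n ℂ)‖ = ‖T‖ := by
  rw [CStarRing.norm_mul_mem_unitary _ (Unitary.star_mem V.2),
    CStarRing.norm_mem_unitary_mul _ V.2]

theorem norm_sub_smul_one {n : Type*} [Fintype n] [DecidableEq n] {W : Matrix n n ℂ}
    (hW : W.IsHermitian) (c : ℝ) :
    ‖W - (c : ℂ) • (1 : Matrix n n ℂ)‖ = ‖fun i => hW.eigenvalues i - c‖ := by
  set V := hW.eigenvectorUnitary
  have hV : (V : Matrix n n ℂ) * star (V : Matrix n n ℂ) = 1 := Unitary.mul_star_self_of_mem V.2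
  have : W - (c : ℂ) • (1 : Matrix n n ℂ) = (V : Matrix n n ℂ) *
      diagonal (fun i => ((hW.eigenvalues i - c : ℝ) : ℂ)) * star (V : Matrix n n ℂ) := by
    have e : diagonal (fun i => ((hW.eigenvalues i - c : ℝ) : ℂ)) =
        diagonal (fun i => (hW.eigenvalues i : ℂ)) - (c : ℂ) • (1 : Matrix n n ℂ) := by
      rw [← diagonal_one, ← diagonal_smul, diagonal_sub]
      congr 1; ext i; simp
    rw [e, mul_sub, sub_mul, ← eq_eigenvectorUnitary_mul hW, mul_smul_comm, mul_one,
      smul_mul_assoc, hV]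
  rw [this, norm_unitary_conj, l2_opNorm_diagonal]
  simp only [Pi.norm_def]
  congr 1
  refine Finset.sup_congr rfl fun i _ => ?_
  ext
  simp only [coe_nnnorm, Complex.norm_real]

/-- The shift `c` is the midpoint of the spectrum. The conservation law survives such a shift, so
the charge may be taken of norm at most `Δ_X / 2`. -/
theorem exists_norm_sub_smul_one_le {n : Type*} [Fintype n] [DecidableEq n] [Nonempty n]
    {W : Matrix n n ℂ} (hW : W.IsHermitian) :
    ∃ c : ℝ, ‖W - (c : ℂ) • (1 : Matrix n n ℂ)‖ ≤ eigenSpread hW / 2 := by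
  refine ⟨((⨆ i, hW.eigenvalues i) + ⨅ i, hW.eigenvalues i) / 2, ?_⟩
  have h1 : ∀ i, hW.eigenvalues i ≤ ⨆ i, hW.eigenvalues i :=
    le_ciSup (Set.finite_range _).bddAbove
  have h2 : ∀ i, ⨅ i, hW.eigenvalues i ≤ hW.eigenvalues i :=
    ciInf_le (Set.finite_range _).bddBelow
  rw [norm_sub_smul_one hW, eigenSpread]
  refine (pi_norm_le_iff_of_nonempty _).2 fun i => ?_
  rw [Real.norm_eq_abs, abs_le]
  constructor <;> linarith [h1 i, h2 i]

/-- The weights `p` are the diagonal of `ρ` in an eigenbasis of `W`. -/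
theorem trace_mul_eq_sum {n : Type*} [Fintype n] [DecidableEq n] {W : Matrix n n ℂ}
    (hW : W.IsHermitian) {ρ : Matrix n n ℂ} (hρ : IsState ρ) :
    ∃ p : n → ℝ, (∀ i, 0 ≤ p i) ∧ ∑ i, p i = 1 ∧
      (ρ * W).trace.re = ∑ i, p i * hW.eigenvalues i := by
  set V := hW.eigenvectorUnitary
  have hV : (V : Matrix n n ℂ) * (V : Matrix n n ℂ)ᴴ = 1 := Unitary.mul_star_self_of_mem V.2
  have hp := hρ.1.conjTranspose_mul_mul_same (V : Matrix n n ℂ)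
  refine ⟨fun i => ((V : Matrix n n ℂ)ᴴ * ρ * V) i i |>.re, fun i => ?_, ?_, ?_⟩
  · exact (Complex.le_def.1 hp.diag_nonneg).1
  · rw [← Complex.re_sum]
    change ((V : Matrix n n ℂ)ᴴ * ρ * V).trace.re = 1
    rw [trace_mul_comm, ← Matrix.mul_assoc, hV, Matrix.one_mul, hρ.2, Complex.one_re]
  · conv_lhs => rw [eq_eigenvectorUnitary_mul hW, ← Matrix.mul_assoc, trace_mul_comm,
      star_eq_conjTranspose, ← Matrix.mul_assoc, ← Matrix.mul_assoc]
    rw [trace, Complex.re_sum]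
    refine Finset.sum_congr rfl fun i _ => ?_
    rw [diag, mul_diagonal, Complex.re_mul_ofReal]

theorem isState_vecMulVec {n : Type*} [Fintype n] {v : n → ℂ} (hv : star v ⬝ᵥ v = 1) :
    IsState (vecMulVec v (star v)) :=
  ⟨posSemidef_vecMulVec_self_star v, by rw [trace_vecMulVec, dotProduct_comm, hv]⟩

/-- Half the difference of the extremal expectation values is attained on two orthogonal
eigenvectors, and compares with the operator norm when the trace vanishes. -/
theorem exists_extremal_eigenvectors {n : Type*} [Fintype n] [DecidableEq n] [Nonempty n]
    {W : Matrix n n ℂ} (hW : W.IsHermitian) :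
    ∃ (lo hi : ℝ) (v : n → n → ℂ) (i j : n), sSup (expectations W) = hi ∧
      sInf (expectations W) = lo ∧ lo ≤ hi ∧
      (∀ k l, star (v k) ⬝ᵥ v l = if k = l then 1 else 0) ∧
      W *ᵥ v i = (hi : ℂ) • v i ∧ W *ᵥ v j = (lo : ℂ) • v j ∧
      |hi| ≤ ‖W‖ ∧ |lo| ≤ ‖W‖ ∧ (W.trace = 0 → ‖W‖ ≤ hi - lo) := by
  obtain ⟨i, hi⟩ := Finite.exists_max hW.eigenvalues
  obtain ⟨j, hj⟩ := Finite.exists_min hW.eigenvalues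
  have hn : ‖W‖ = ‖hW.eigenvalues‖ := by simpa using norm_sub_smul_one hW 0
  have hle : ∀ k, |hW.eigenvalues k| ≤ ‖W‖ := fun k => hn ▸ norm_le_pi_norm hW.eigenvalues k
  set v : n → n → ℂ := fun k => hW.eigenvectorBasis k with hv
  have hon : ∀ k l, star (v k) ⬝ᵥ v l = if k = l then 1 else 0 := by
    intro k l
    have := orthonormal_iff_ite.1 hW.eigenvectorBasis.orthonormal k l
    rw [← this, EuclideanSpace.inner_eq_star_dotProduct, dotProduct_comm]
  have heig : ∀ k, W *ᵥ v k = (hW.eigenvalues k : ℂ) • v k := fun k =>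
    hW.mulVec_eigenvectorBasis k
  have hmem : ∀ k, hW.eigenvalues k ∈ expectations W := by
    intro k
    refine ⟨_, isState_vecMulVec (v := v k) (by rw [hon, if_pos rfl]), ?_⟩
    rw [trace_mul_comm, mul_vecMulVec, heig, trace_vecMulVec, smul_dotProduct, dotProduct_comm, hon]
    simp
  have hsup : sSup (expectations W) = hW.eigenvalues i := by
    refine IsGreatest.csSup_eq ⟨hmem i, ?_⟩
    rintro _ ⟨ρ, hρ, rfl⟩
    obtain ⟨p, hp0, hp1, hp⟩ := trace_mul_eq_sum hW hρ
    rw [hp]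
    calc _ ≤ ∑ k, p k * hW.eigenvalues i :=
          Finset.sum_le_sum fun k _ => mul_le_mul_of_nonneg_left (hi k) (hp0 k)
      _ = _ := by rw [← Finset.sum_mul, hp1, one_mul]
  have hinf : sInf (expectations W) = hW.eigenvalues j := by
    refine IsLeast.csInf_eq ⟨hmem j, ?_⟩
    rintro _ ⟨ρ, hρ, rfl⟩
    obtain ⟨p, hp0, hp1, hp⟩ := trace_mul_eq_sum hW hρ
    rw [hp]
    calc _ = ∑ k, p k * hW.eigenvalues j := by rw [← Finset.sum_mul, hp1, one_mul]
      _ ≤ _ := Finset.sum_le_sum fun k _ => mul_le_mul_of_nonneg_left (hj k) (hp0 k)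
  refine ⟨_, _, v, i, j, hsup, hinf, hi j, hon, heig i, heig j, hle i, hle j, fun h0 => ?_⟩
  -- Vanishing trace puts `0` between the extremal eigenvalues, so no modulus exceeds their
  -- difference.
  have hs : ∑ k, hW.eigenvalues k = 0 := by
    have := hW.trace_eq_sum_eigenvalues
    rw [h0] at this
    have h2 := congrArg Complex.re this
    simpa using h2.symm
  have h1 : 0 ≤ hW.eigenvalues i := by
    by_contra! hneg
    have := Finset.sum_lt_sum_of_nonempty (s := (Finset.univ : Finset n)) Finset.univ_nonempty
      (fun k _ => (hi k).trans_lt hneg)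
    simp [hs] at this
  have h2 : hW.eigenvalues j ≤ 0 := by
    by_contra! hneg
    have := Finset.sum_lt_sum_of_nonempty (s := (Finset.univ : Finset n)) Finset.univ_nonempty
      (fun k _ => hneg.trans_le (hj k))
    simp [hs] at this
  rw [hn]
  refine (pi_norm_le_iff_of_nonempty _).2 fun k => ?_
  rw [Real.norm_eq_abs, abs_le]
  constructor <;> linarith [hi k, hj k]

/-- The states of the two-dimensional space of two orthonormal vectors that are used to test an
implementation. -/
theorem exists_test_states {n : Type*} [Fintype n] [DecidableEq n] {u w : n → ℂ}
    (huu : star u ⬝ᵥ u = 1) (hww : star w ⬝ᵥ w = 1) (huw : star u ⬝ᵥ w = 0)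
    {Y : Matrix n n ℂ} (hY : Y.IsHermitian) {hi lo : ℝ} (hu : Y *ᵥ u = (hi : ℂ) • u)
    (hw : Y *ᵥ w = (lo : ℂ) • w) :
    ∃ χ χ' φ : n → ℂ, star χ ⬝ᵥ χ = 1 ∧ star χ' ⬝ᵥ χ' = 1 ∧ star χ ⬝ᵥ χ' = 0 ∧
      star φ ⬝ᵥ φ = 1 ∧
      vecMulVec χ (star χ) * vecMulVec φ (star φ) * vecMulVec χ (star χ)
        = (1 / 2 : ℂ) • vecMulVec χ (star χ) ∧
      (1 - vecMulVec χ (star χ)) * vecMulVec φ (star φ) * (1 - vecMulVec χ (star χ))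
        = (1 / 2 : ℂ) • vecMulVec χ' (star χ') ∧
      ‖(vecMulVec φ (star φ) * (Y * vecMulVec χ (star χ) - vecMulVec χ (star χ) * Y)).trace‖
        = |hi - lo| / 2 := by
  have hwu : star w ⬝ᵥ u = 0 := by
    have := congrArg star huw
    rwa [star_zero, star_dotProduct, star_star] at this
  set s : ℂ := (((√2)⁻¹ : ℝ) : ℂ) with hs
  have hss : s * s = 1 / 2 := by
    rw [hs, ← Complex.ofReal_mul, ← mul_inv, Real.mul_self_sqrt (by norm_num)]
    simp
  have hstar : star s = s := by rw [hs]; exact Complex.conj_ofReal _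
  have hI : star Complex.I = -Complex.I := Complex.conj_I
  -- `χ` and `χ'` are orthogonal and `φ` has equal weight on both. The relative phase `i` maximizes
  -- the commutator expectation; a real phase would make it vanish.
  set χ : n → ℂ := s • (u + Complex.I • w) with hχ
  set χ' : n → ℂ := s • (u - Complex.I • w) with hχ'
  set φ : n → ℂ := s • (u + w) with hφ
  have inner_eq : ∀ x y z t : ℂ, star (s • (x • u + y • w)) ⬝ᵥ (s • (z • u + t • w)) =
      (star x * z + star y * t) / 2 := by
    intro x y z t
    simp only [star_smul, star_add, add_dotProduct, dotProduct_add, smul_dotProduct,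
      dotProduct_smul, huu, hww, huw, hwu, smul_eq_mul, hstar]
    linear_combination (star x * z + star y * t) * hss
  have eχ : χ = s • ((1 : ℂ) • u + Complex.I • w) := by rw [one_smul]
  have eχ' : χ' = s • ((1 : ℂ) • u + (-Complex.I) • w) := by rw [one_smul, neg_smul, ← sub_eq_add_neg]
  have eφ : φ = s • ((1 : ℂ) • u + (1 : ℂ) • w) := by rw [one_smul, one_smul]
  have eY : Y *ᵥ χ = s • ((hi : ℂ) • u + (Complex.I * lo) • w) := by
    rw [hχ, mulVec_smul, mulVec_add, mulVec_smul, hu, hw, smul_smul]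
  have hII := Complex.I_mul_I
  have i1 : star χ ⬝ᵥ φ = (1 - Complex.I) / 2 := by
    rw [eχ, eφ, inner_eq, hI, star_one]; ring
  have i2 : star φ ⬝ᵥ χ = (1 + Complex.I) / 2 := by
    rw [eχ, eφ, inner_eq, star_one]; ring
  have i3 : star φ ⬝ᵥ (Y *ᵥ χ) = (hi + Complex.I * lo) / 2 := by
    rw [eY, eφ, inner_eq, star_one]; ring
  have i4 : star (Y *ᵥ χ) ⬝ᵥ φ = (hi - Complex.I * lo) / 2 := by
    rw [eY, eφ, inner_eq, star_mul, hI]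
    simp only [RCLike.star_def, Complex.conj_ofReal]; ring
  refine ⟨χ, χ', φ, ?_, ?_, ?_, ?_, ?_, ?_, ?_⟩
  · rw [eχ, inner_eq, hI, star_one]; linear_combination (-1 / 2) * hII
  · rw [eχ', inner_eq, star_neg, hI, star_one]; linear_combination (-1 / 2) * hII
  · rw [eχ, eχ', inner_eq, hI, star_one]; linear_combination (1 / 2) * hII
  · rw [eφ, inner_eq, star_one]; ring
  · rw [vecMulVec_mul_vecMulVec, vecMulVec_mul_vecMulVec, i1, smul_dotProduct, i2, vecMulVec_smul,
      smul_eq_mul]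
    congr 1
    linear_combination (-1 / 4) * hII
  · have hξ : (1 - vecMulVec χ (star χ)) *ᵥ φ = ((1 + Complex.I) / 2) • χ' := by
      rw [sub_mulVec, one_mulVec, vecMulVec_mulVec, i1, hφ, hχ, hχ']
      ext k
      simp
      linear_combination (s * w k) * hII
    have hP : (1 - vecMulVec χ (star χ))ᴴ = 1 - vecMulVec χ (star χ) := by
      rw [conjTranspose_sub, conjTranspose_one, (posSemidef_vecMulVec_self_star χ).1]
    have hξ' : star φ ᵥ* (1 - vecMulVec χ (star χ)) = star (((1 + Complex.I) / 2) • χ') := by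
      rw [← hξ, star_mulVec, hP]
    rw [mul_vecMulVec, vecMulVec_mul, hξ, hξ', star_smul, vecMulVec_smul, smul_vecMulVec, smul_smul]
    congr 1
    simp only [star_div₀, star_add, star_one, hI, star_ofNat]
    linear_combination (-1 / 4) * hII
  · have hv : vecMulVec χ (star χ) * Y = vecMulVec χ (star (Y *ᵥ χ)) := by
      rw [vecMulVec_mul, star_mulVec, hY.eq]
    rw [mul_sub, trace_sub, mul_vecMulVec, hv, vecMulVec_mul_vecMulVec,
      vecMulVec_mul_vecMulVec, trace_vecMulVec, trace_vecMulVec, dotProduct_smul,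
      dotProduct_smul, dotProduct_comm φ, dotProduct_comm φ, i1, i2, i3, i4]
    have : (((hi : ℂ) + Complex.I * lo) / 2) • ((1 - Complex.I) / 2) -
        ((1 + Complex.I) / 2) • (((hi : ℂ) - Complex.I * lo) / 2) =
        ((-(hi - lo) / 2 : ℝ) : ℂ) * Complex.I := by
      simp only [smul_eq_mul]
      push_cast
      ring
    rw [this, norm_mul, Complex.norm_I, mul_one, Complex.norm_real, Real.norm_eq_abs, abs_div,
      abs_neg, abs_two]

/-! ### Pure states, and the asymmetry against the norm of the commutator. -/

theorem vecMulVec_mul_self {n : Type*} [Fintype n] {v : n → ℂ} (hv : star v ⬝ᵥ v = 1) :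
    vecMulVec v (star v) * vecMulVec v (star v) = vecMulVec v (star v) := by
  rw [vecMulVec_mul_vecMulVec, hv, one_smul]

theorem vecMulVec_mul_mul_vecMulVec {n : Type*} [Fintype n] (v : n → ℂ) (T : Matrix n n ℂ) :
    vecMulVec v (star v) * T * vecMulVec v (star v)
      = (vecMulVec v (star v) * T).trace • vecMulVec v (star v) := by
  rw [vecMulVec_mul, vecMulVec_mul_vecMulVec, trace_vecMulVec, vecMulVec_smul, dotProduct_comm]

/-- For a pure target the squared fidelity is a probability, linear in `τ`. -/
theorem one_sub_sq_le_of_purifiedDist_le {n : Type*} [Fintype n] [DecidableEq n]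
    {τ : Matrix n n ℂ} (hτ : τ.PosSemidef) (v : n → ℂ) {ε : ℝ}
    (h : purifiedDist τ (vecMulVec v (star v)) ≤ ε) :
    1 - ε ^ 2 ≤ (τ * vecMulVec v (star v)).trace.re := by
  rw [purifiedDist, fidelity_vecMulVec hτ] at h
  have := (Real.sqrt_le_iff.1 h).2
  linarith

theorem norm_eq_opNorm {n : Type*} [Fintype n] [DecidableEq n] (M : Matrix n n ℂ) :
    ‖M‖ = opNorm M := rfl

theorem eigenSpread_nonneg {n : Type*} [Fintype n] [DecidableEq n] [Nonempty n]
    {W : Matrix n n ℂ} (hW : W.IsHermitian) : 0 ≤ eigenSpread hW := by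
  obtain ⟨c, hc⟩ := exists_norm_sub_smul_one_le hW
  linarith [norm_nonneg (W - (c : ℂ) • (1 : Matrix n n ℂ))]

theorem isHermitian_sub_conj {n : Type*} [Fintype n] {X : Matrix n n ℂ} (hX : X.IsHermitian)
    (U : Matrix n n ℂ) : (X - Uᴴ * X * U).IsHermitian :=
  hX.sub (isHermitian_conjTranspose_mul_mul U hX)

/-- `Uᴴ (X U - U X) = -(X - Uᴴ X U)`, and a unitary factor preserves the norm. -/
theorem norm_commutator {n : Type*} [Fintype n] [DecidableEq n] (X : Matrix n n ℂ)
    {U : Matrix n n ℂ} (hU : U ∈ unitaryGroup n ℂ) :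
    ‖X * U - U * X‖ = ‖X - Uᴴ * X * U‖ := by
  have hUU : Uᴴ * U = 1 := mem_unitaryGroup_iff'.1 hU
  have : Uᴴ * (X * U - U * X) = -(X - Uᴴ * X * U) := by
    rw [mul_sub, ← Matrix.mul_assoc, ← Matrix.mul_assoc, hUU, Matrix.one_mul, neg_sub]
  rw [← norm_neg (X - Uᴴ * X * U), ← this, ← star_eq_conjTranspose,
    CStarRing.norm_mem_unitary_mul _ (Unitary.star_mem hU)]

theorem asymmetry_le_norm {n : Type*} [Fintype n] [DecidableEq n] [Nonempty n]
    {X : Matrix n n ℂ} (hX : X.IsHermitian) (U : Matrix n n ℂ) :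
    asymmetry X U ≤ ‖X - Uᴴ * X * U‖ := by
  obtain ⟨lo, hi, v, i, j, hsup, hinf, -, -, -, -, h1, h2, -⟩ :=
    exists_extremal_eigenvectors (isHermitian_sub_conj hX U)
  rw [asymmetry, hsup, hinf]
  linarith [abs_le.1 h1, abs_le.1 h2]

theorem norm_le_two_mul_asymmetry {n : Type*} [Fintype n] [DecidableEq n] [Nonempty n]
    {X U : Matrix n n ℂ} (hX : X.IsHermitian) (hU : U ∈ unitaryGroup n ℂ) :
    ‖X - Uᴴ * X * U‖ ≤ 2 * asymmetry X U := by
  obtain ⟨lo, hi, v, i, j, hsup, hinf, -, -, -, -, -, -, h⟩ :=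
    exists_extremal_eigenvectors (isHermitian_sub_conj hX U)
  rw [asymmetry, hsup, hinf]
  have hUU : U * Uᴴ = 1 := mem_unitaryGroup_iff.1 hU
  refine (h ?_).trans_eq (by ring)
  rw [trace_sub, trace_mul_comm, ← Matrix.mul_assoc, hUU, Matrix.one_mul, sub_self]

/-! ### The bound for one implementation and for the cost. -/

/-- Lower bound on the quantum Fisher information used by an implementation. -/
theorem Implementation.ofReal_le_fisherInfo {a : Type*} [Fintype a] [DecidableEq a] [Nonempty a]
    {X U : Matrix a a ℂ} (hX : X.IsHermitian) (hU : U ∈ unitaryGroup a ℂ)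
    {E : Matrix a a ℂ →ₗ[ℂ] Matrix a a ℂ} (I : Implementation X X E) {ε : ℝ} (hε : 0 < ε)
    (happrox : ∀ ρ : Matrix a a ℂ, IsState ρ → purifiedDist (E ρ) (U * ρ * Uᴴ) ≤ ε)
    (h0 : 0 ≤ asymmetry X U / (√2 * ε) - 3 * eigenSpread hX) :
    ENNReal.ofReal ((asymmetry X U / (√2 * ε) - 3 * eigenSpread hX) ^ 2) ≤
      fisherInfo I.ρB I.XB := by
  have hUU : Uᴴ * U = 1 := mem_unitaryGroup_iff'.1 hU
  have hUU' : U * Uᴴ = 1 := mem_unitaryGroup_iff.1 hU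
  obtain ⟨c, hc⟩ := exists_norm_sub_smul_one_le hX
  obtain ⟨lo, hi, v, i, j, hsup, hinf, hlohi, hon, hvi, hvj, -, -, -⟩ :=
    exists_extremal_eigenvectors (isHermitian_sub_conj hX U)
  have hA : asymmetry X U = |hi - lo| / 2 := by
    rw [asymmetry, hsup, hinf, abs_of_nonneg (sub_nonneg.2 hlohi)]
  have hΔ := eigenSpread_nonneg hX
  -- A common eigenvector forces `hi = lo`; then the asymmetry is zero and `h0` makes the left side
  -- vanish.
  by_cases hij : i = j
  · have hl : (hi : ℂ) = lo := by
      subst hij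
      have e := congrArg (star (v i) ⬝ᵥ ·) (hvi.symm.trans hvj)
      simpa [dotProduct_smul, hon] using e
    have hz : asymmetry X U = 0 := by
      rw [hA, Complex.ofReal_injective hl]; simp
    rw [hz, zero_div] at h0 ⊢
    have : 0 - 3 * eigenSpread hX = 0 := by linarith
    simp [this]
  obtain ⟨χ, χ', φ, hχ, hχ', hχχ', hφ, hin, hout, hcomm⟩ := exists_test_states
    (u := v i) (w := v j) (by rw [hon, if_pos rfl]) (by rw [hon, if_pos rfl])
    (by rw [hon, if_neg hij]) (isHermitian_sub_conj hX U) hvi hvj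
  set X₀ := X - (c : ℂ) • (1 : Matrix a a ℂ) with hX₀
  -- Undoing `U` at the output makes the approximated channel the identity, at the price of
  -- replacing the output charge by `Uᴴ X₀ U`.
  set W := (Uᴴ ⊗ₖ (1 : Matrix (Fin I.b') (Fin I.b') ℂ)) * I.U with hWdef
  have hWh : Wᴴ = I.Uᴴ * (U ⊗ₖ (1 : Matrix (Fin I.b') (Fin I.b') ℂ)) := by
    rw [hWdef, conjTranspose_mul, conjTranspose_kronecker, conjTranspose_conjTranspose,
      conjTranspose_one]
  have hk : (U ⊗ₖ (1 : Matrix (Fin I.b') (Fin I.b') ℂ)) * (Uᴴ ⊗ₖ 1) = 1 := by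
    rw [← mul_kronecker_mul, hUU', one_mul, one_kronecker_one]
  have hk' : (Uᴴ ⊗ₖ (1 : Matrix (Fin I.b') (Fin I.b') ℂ)) * (U ⊗ₖ 1) = 1 := by
    rw [← mul_kronecker_mul, hUU, one_mul, one_kronecker_one]
  have hW : Wᴴ * W = 1 := by
    rw [hWh, hWdef, Matrix.mul_assoc, ← Matrix.mul_assoc (U ⊗ₖ 1), hk, Matrix.one_mul,
      I.unitary_left]
  have hW' : W * Wᴴ = 1 := by
    rw [hWh, hWdef, Matrix.mul_assoc, ← Matrix.mul_assoc I.U, I.unitary_right, Matrix.one_mul, hk']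
  have hcons : Wᴴ * ((Uᴴ * X₀ * U) ⊗ₖ (1 : Matrix (Fin I.b') (Fin I.b') ℂ)
      + (1 : Matrix a a ℂ) ⊗ₖ I.XB') * W
      = X₀ ⊗ₖ (1 : Matrix (Fin I.b) (Fin I.b) ℂ) + (1 : Matrix a a ℂ) ⊗ₖ I.XB := by
    have e1 : (U ⊗ₖ (1 : Matrix (Fin I.b') (Fin I.b') ℂ)) *
        ((Uᴴ * X₀ * U) ⊗ₖ 1 + (1 : Matrix a a ℂ) ⊗ₖ I.XB') * (Uᴴ ⊗ₖ 1)
        = X ⊗ₖ 1 + (1 : Matrix a a ℂ) ⊗ₖ I.XB' - (c : ℂ) • 1 := by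
      have e2 : U * (Uᴴ * X₀ * U) * Uᴴ = X₀ := by
        rw [Matrix.mul_assoc, Matrix.mul_assoc, hUU', Matrix.mul_one, ← Matrix.mul_assoc, hUU',
          Matrix.one_mul]
      rw [mul_add, add_mul, ← mul_kronecker_mul, ← mul_kronecker_mul, ← mul_kronecker_mul,
        ← mul_kronecker_mul, e2, one_mul, one_mul, mul_one, mul_one, hUU', hX₀, sub_kronecker,
        smul_kronecker, one_kronecker_one, Matrix.one_mul]
      abel
    rw [hWh, hWdef]
    have e3 : ∀ K Z L : Matrix (a × Fin I.b') (a × Fin I.b') ℂ,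
        I.Uᴴ * K * Z * (L * I.U) = I.Uᴴ * (K * Z * L) * I.U := by
      intro K Z L
      simp only [Matrix.mul_assoc]
    rw [e3, e1, Matrix.mul_sub, Matrix.sub_mul, I.conservation, Matrix.mul_smul, Matrix.mul_one,
      Matrix.smul_mul, I.unitary_left, hX₀, sub_kronecker, smul_kronecker, one_kronecker_one]
    abel
  have hstate : ∀ x : a → ℂ, star x ⬝ᵥ x = 1 →
      1 - ε ^ 2 ≤ (partialTrace (W * (vecMulVec x (star x) ⊗ₖ I.ρB) * Wᴴ) *
        vecMulVec x (star x)).trace.re := by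
    intro x hx
    have hS := isState_vecMulVec hx
    have h := happrox _ hS
    have hES : IsState (E (vecMulVec x (star x))) := by
      rw [I.realizes]
      exact ((hS.kronecker I.isState).conj I.unitary_left).partialTrace
    have hv : U * vecMulVec x (star x) * Uᴴ = vecMulVec (U *ᵥ x) (star (U *ᵥ x)) := by
      rw [mul_vecMulVec, vecMulVec_mul, star_mulVec]
    rw [hv] at h
    refine (one_sub_sq_le_of_purifiedDist_le hES.1 _ h).trans_eq ?_
    rw [← hv, I.realizes, trace_partialTrace_mul, trace_partialTrace_mul, hWh, hWdef]
    have e : (U * vecMulVec x (star x) * Uᴴ) ⊗ₖ (1 : Matrix (Fin I.b') (Fin I.b') ℂ) =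
        (U ⊗ₖ 1) * (vecMulVec x (star x) ⊗ₖ 1) * (Uᴴ ⊗ₖ 1) := by
      rw [← mul_kronecker_mul, ← mul_kronecker_mul, one_mul, one_mul]
    rw [e, ← Matrix.mul_assoc, trace_mul_comm]
    simp only [Matrix.mul_assoc]
  have hX₀h : X₀.IsHermitian := by
    refine hX.sub ?_
    rw [Matrix.IsHermitian, conjTranspose_smul, conjTranspose_one]
    simp
  have hXn : ‖Uᴴ * X₀ * U‖ ≤ eigenSpread hX / 2 := by
    rw [CStarRing.norm_mul_mem_unitary _ hU, ← star_eq_conjTranspose,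
      CStarRing.norm_mem_unitary_mul _ (Unitary.star_mem hU)]
    exact hc
  have hY : X₀ - Uᴴ * X₀ * U = X - Uᴴ * X * U := by
    rw [hX₀, mul_sub, sub_mul, mul_smul_comm, mul_one, smul_mul_assoc, hUU]
    abel
  set d := (asymmetry X U / (√2 * ε) - 3 * eigenSpread hX) * (√2 * ε) with hd
  have h2 : (0 : ℝ) < √2 := by positivity
  have hpos : 0 < √2 * ε := by positivity
  have hdd : d / (√2 * ε) = asymmetry X U / (√2 * ε) - 3 * eigenSpread hX := by
    rw [hd, mul_div_assoc, div_self hpos.ne', mul_one]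
  -- With `κ = Δ_X / 2` the loss `8κε` is `4 Δ_X ε`, and `4 ≤ 3√2` absorbs it into `3 Δ_X · √2 ε`.
  have hsqrt : 4 / 3 ≤ √2 := Real.le_sqrt_of_sq_le (by norm_num)
  rw [← hdd]
  refine ofReal_le_fisherInfo_of_conservation hW hW' I.isState hX₀h I.hermitian_XB hcons
    (isState_vecMulVec hχ) (vecMulVec_mul_self hχ) (isState_vecMulVec hχ') (vecMulVec_mul_self hχ')
    ?_ (isState_vecMulVec hφ) (vecMulVec_mul_self hφ) (vecMulVec_mul_mul_vecMulVec φ) hin hout hε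
    hc hXn ?_ (mul_nonneg h0 hpos.le) ?_
  · rw [vecMulVec_mul_vecMulVec, hχχ', zero_smul, vecMulVec_zero]
  · rintro S (rfl | rfl | rfl)
    · exact hstate χ hχ
    · exact hstate χ' hχ'
    · exact hstate φ hφ
  · rw [hY, hcomm, ← hA, hd, sub_mul, div_mul_cancel₀ _ hpos.ne']
    have := mul_nonneg hΔ hε.le
    nlinarith

theorem ofReal_le_sqrt_cost {a : Type*} [Fintype a] [DecidableEq a] [Nonempty a]
    {X U : Matrix a a ℂ} (hX : X.IsHermitian) (hU : U ∈ unitaryGroup a ℂ)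
    {E : Matrix a a ℂ →ₗ[ℂ] Matrix a a ℂ} {ε : ℝ} (hε : 0 < ε)
    (happrox : ∀ ρ : Matrix a a ℂ, IsState ρ → purifiedDist (E ρ) (U * ρ * Uᴴ) ≤ ε) :
    ENNReal.ofReal (asymmetry X U / (√2 * ε) - 3 * eigenSpread hX)
      ≤ cost X X E ^ (1 / 2 : ℝ) := by
  -- A negative bound is truncated to `0` by `ENNReal.ofReal`; squaring is legitimate only in the
  -- other case.
  rcases le_total (asymmetry X U / (√2 * ε) - 3 * eigenSpread hX) 0 with h0 | h0
  · rw [ENNReal.ofReal_of_nonpos h0]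
    exact zero_le
  · have h : ENNReal.ofReal ((asymmetry X U / (√2 * ε) - 3 * eigenSpread hX) ^ 2)
        ≤ cost X X E := le_iInf fun I => I.ofReal_le_fisherInfo hX hU hε happrox h0
    refine le_trans (le_of_eq ?_) (ENNReal.rpow_le_rpow h (by norm_num : (0 : ℝ) ≤ 1 / 2))
    rw [ENNReal.ofReal_rpow_of_nonneg (sq_nonneg _) (by norm_num), ← Real.sqrt_eq_rpow,
      Real.sqrt_sq h0]

end QCost

end

theorem mainTheorem7 {a : Type*} [Fintype a] [DecidableEq a] [Nonempty a]
    (X U : Matrix a a ℂ) (hX : X.IsHermitian) (hU : U ∈ Matrix.unitaryGroup a ℂ)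
    (E : Matrix a a ℂ →ₗ[ℂ] Matrix a a ℂ) (hE : QCost.IsCPTP E)
    (ε : ℝ) (hε : 0 < ε)
    (happrox : ∀ ρ : Matrix a a ℂ, QCost.IsState ρ →
      QCost.purifiedDist (E ρ) (U * ρ * U.conjTranspose) ≤ ε) :
    ENNReal.ofReal (QCost.asymmetry X U / (√2 * ε) - 3 * QCost.eigenSpread hX)
        ≤ QCost.cost X X E ^ (1 / 2 : ℝ)
      ∧ QCost.asymmetry X U ≤ QCost.opNorm (X * U - U * X)
      ∧ QCost.opNorm (X * U - U * X) ≤ 2 * QCost.asymmetry X U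
      ∧ ENNReal.ofReal
          (QCost.opNorm (X * U - U * X) / (2 * √2 * ε) - 3 * QCost.eigenSpread hX)
        ≤ QCost.cost X X E ^ (1 / 2 : ℝ) := by
  have hnorm := (QCost.norm_eq_opNorm (X * U - U * X)).symm.trans (QCost.norm_commutator X hU)
  have h1 := QCost.ofReal_le_sqrt_cost hX hU hε happrox
  have h2 := QCost.asymmetry_le_norm hX U
  have h3 := QCost.norm_le_two_mul_asymmetry hX hU
  rw [← hnorm] at h2 h3
  refine ⟨h1, h2, h3, (ENNReal.ofReal_le_ofReal (sub_le_sub_right ?_ _)).trans h1⟩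
  have hpos : 0 < √2 * ε := by positivity
  rw [div_le_div_iff₀ (by positivity) hpos]
  nlinarith
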